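/- All matroids and digraphs are finite. A class of matroids (closed under isomorphism) is \emph{complete} if it is closed under minors, duals, direct sums, truncations, and induction by directed graphs. Here, for a digraph $\Gamma$ and a matroid $M$ with $E(M)\subseteq V(\Gamma)$, the induced matroid $\Gamma(M)$ is the matroid on $V(\Gamma)$ in which a set $X$ is independent if and only if $X$ can be linked to some independent set $Y$ of $M$, that is, there are $|X|$ pairwise vertex-disjoint directed paths of $\Gamma$ whose set of initial vertices is $X$ and whose set of terminal vertices is $Y$. Let $k,l\ge 0$ be integers with $k+l>0$. A matroid $M$ of rank $r(M)$ is \emph{$(k,l)$-base-orderable} if for any two bases $B_1,B_2$ of $M$ there is a bijection $\sigma\colon B_1\to B_2$ such that, for every $X\subseteq B_1$ with $|X|\le k$ or $|X|\ge r(M)-l$, the set $(B_1-X)\cup\sigma(X)$ is a basis of $M$. (No relation between $k$, $l$ and $r(M)$ is required.) **Theorem.** For all fixed integers $k,l\ge 0$ with $k+l>0$, the class of $(k,l)$-base-orderable matroids is complete. -/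

import Mathlib

universe u

namespace CompleteMatroidClass

/-- A collection of matroids, on arbitrary ground types in the universe `u`. -/
abbrev MatroidCollection : Type (u + 1) := ∀ ⦃α : Type u⦄, Matroid α → Prop

/-- `M` and `N` are isomorphic: there is a bijection between their ground sets that preserves
independence in both directions. -/
def Isomorphic {α β : Type*} (M : Matroid α) (N : Matroid β) : Prop :=
  ∃ e : ↥M.E ≃ ↥N.E, ∀ I : Set ↥M.E,
    M.Indep (Subtype.val '' I) ↔ N.Indep (Subtype.val '' (e '' I))

/-- The truncation of `M` to rank at most `k`: its independent sets are the independent sets of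
`M` that have at most `k` elements. For `k = r(M) - 1` this is the (elementary) truncation
of `M`, for smaller `k` it is an iterated truncation, and for `k ≥ r(M)` it is `M`. -/
def truncation {α : Type*} (M : Matroid α) (k : ℕ) : Matroid α :=
  (IndepMatroid.ofBddAugment (E := M.E) (Indep := fun I => M.Indep I ∧ I.encard ≤ k)
    (indep_empty := ⟨M.empty_indep, by simp⟩)
    (indep_subset := fun _ _ hJ hIJ => ⟨hJ.1.subset hIJ, (Set.encard_le_encard hIJ).trans hJ.2⟩)
    (indep_aug := by
      rintro I J ⟨hI, -⟩ ⟨hJ, hJk⟩ hIJ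
      obtain ⟨e, he, hins⟩ := hI.augment hJ hIJ
      refine ⟨e, he.1, he.2, hins, ?_⟩
      rw [Set.encard_insert_of_notMem he.2]
      exact (Order.add_one_le_of_lt hIJ).trans hJk)
    (indep_bdd := ⟨k, fun _ hI => hI.2⟩)
    (subset_ground := fun _ hI => hI.1.subset_ground)).matroid

/-- `p` is the vertex list of a directed path of `Γ` from `a` to `b`
(a single vertex is a path from itself to itself). -/
def IsDirectedPath {V : Type*} (Γ : Digraph V) (p : List V) (a b : V) : Prop :=
  p.IsChain Γ.Adj ∧ p.Nodup ∧ p.head? = some a ∧ p.getLast? = some b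

/-- `X` is linked to `Y` in the digraph `Γ`: there are pairwise vertex-disjoint directed paths
whose initial vertices are exactly the elements of `X`, each once, and whose terminal vertices are
exactly the elements of `Y`, each once. -/
def IsLinked {V : Type*} (Γ : Digraph V) (X Y : Set V) : Prop :=
  ∃ (t : ↥X ≃ ↥Y) (P : ↥X → List V),
    (∀ x : ↥X, IsDirectedPath Γ (P x) x (t x)) ∧
    ∀ x x' : ↥X, x ≠ x' → List.Disjoint (P x) (P x')

/-- `N` is the matroid `Γ(M)` induced from `M` by the digraph `Γ`: its ground set is the
vertex set of `Γ`, and a set is independent precisely if it is linked in `Γ` to an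
independent set of `M`. -/
def IsInducedBy {V : Type*} (Γ : Digraph V) (M N : Matroid V) : Prop :=
  N.E = Set.univ ∧ ∀ X : Set V, N.Indep X ↔ ∃ Y : Set V, M.Indep Y ∧ IsLinked Γ X Y

/-- There is at most one matroid induced from `M` by `Γ`. -/
theorem IsInducedBy.unique {V : Type*} {Γ : Digraph V} {M N N' : Matroid V}
    (h : IsInducedBy Γ M N) (h' : IsInducedBy Γ M N') : N = N' :=
  Matroid.ext_indep (h.1.trans h'.1.symm) fun X _ => (h.2 X).trans (h'.2 X).symm

/-- A class of (finite) matroids: a collection of finite matroids that is closed under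
isomorphism. -/
structure IsMatroidClass (C : MatroidCollection.{u}) : Prop where
  finite : ∀ {α : Type u} (M : Matroid α), C M → M.Finite
  iso : ∀ {α β : Type u} (M : Matroid α) (N : Matroid β), C M → Isomorphic M N → C N

/-- A class of matroids is complete if it is closed under minors, duals, direct sums, truncations,
and induction by (finite) directed graphs. The last field also says that the
induced matroid exists; it is unique by `IsInducedBy.unique`. -/
structure IsComplete (C : MatroidCollection.{u}) : Prop extends IsMatroidClass C where
  minor : ∀ {α : Type u} (M N : Matroid α), C M → N.IsMinor M → C N
  dual : ∀ {α : Type u} (M : Matroid α), C M → C M.dual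
  directSum : ∀ {α β : Type u} (M : Matroid α) (N : Matroid β), C M → C N → C (M.sum N)
  truncation : ∀ {α : Type u} (M : Matroid α) (k : ℕ), C M →
    C (CompleteMatroidClass.truncation M k)
  induced : ∀ {V : Type u} [Finite V] (Γ : Digraph V) (M : Matroid V), C M →
    ∃ N : Matroid V, IsInducedBy Γ M N ∧ C N

/-- The finite matroid `M` is `(k,l)`-base-orderable: for any two bases `B₁` and `B₂` there is a
bijection `σ : B₁ → B₂` such that `(B₁ - X) ∪ σ(X)` is a basis for every `X ⊆ B₁` with `|X| ≤ k`
or `|X| ≥ r(M) - l`, where the last inequality is written `r(M) ≤ |X| + l`. -/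
def KLBaseOrderable (k l : ℕ) : MatroidCollection.{u} := fun _ M =>
  M.Finite ∧ ∀ B₁ B₂, M.IsBase B₁ → M.IsBase B₂ → ∃ σ : ↥B₁ ≃ ↥B₂, ∀ X : Set ↥B₁,
    (X.encard ≤ k ∨ M.eRank ≤ X.encard + l) →
      M.IsBase ((B₁ \ (Subtype.val '' X)) ∪ Subtype.val '' (σ '' X))

end CompleteMatroidClass

open Set
open scoped Matroid

namespace CompleteMatroidClass

variable {α β : Type*}

/-! The condition is first put in a self-dual form. Since k + l > 0, the bijection σ must fix B₁ ∩
B₂, as otherwise some admissible exchange would be a proper subset of a base. So only X ⊆ B₁ \ B₂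
matters, with at most k elements in X or at most l elements of B₁ \ B₂ outside X. Complementing X
inverts σ and interchanges k and l, which yields duals. Restrictions follow by completing both bases
with the same set, which σ fixes; contractions follow by duality.

Truncation and induction rest on `IsExchangeMap.exists_of_insert`: an exchange map from I + f to J +
g can be shortcut to a bijection τ : I → J whose admissible exchanges become bases of M after adding
f or g. This lowers the rank by one, and it also handles a principal extension by e placed freely on
a set containing f and g, when both bases contain e.

Adding a new copy of every vertex v, placed freely on A v, and restricting to the copies gives
induction along a bipartite graph. For digraphs, B is linked to Y exactly when Bᶜ can be matched
onto Yᶜ, each v going to itself or to an in-neighbour. Hence the dual of Γ(M) is induced from the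
dual of M by a bipartite graph. -/

/-! ### Exchange maps and their symmetry -/

/-- `σ` exchanges the base `B₁` for `B₂` in such a way that swapping any set of at most `k`
elements, or all but at most `l` elements, of `B₁ \ B₂` produces a base. -/
structure IsExchangeMap (M : Matroid α) (k l : ℕ) (B₁ B₂ : Set α) (σ : α → α) : Prop where
  bijOn : BijOn σ B₁ B₂
  eq_self : ∀ x ∈ B₁, x ∈ B₂ → σ x = x
  isBase : ∀ X ⊆ B₁ \ B₂, (X.encard ≤ k ∨ ((B₁ \ B₂) \ X).encard ≤ l) →
    M.IsBase ((B₁ \ X) ∪ σ '' X)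

/-- Elements of X ∩ B₂ are fixed by σ, so exchanging them changes nothing. -/
theorem IsExchangeMap.isBase_of_subset {M : Matroid α} {k l : ℕ} {B₁ B₂ X : Set α} {σ : α → α}
    (h : IsExchangeMap M k l B₁ B₂ σ) (hX : X ⊆ B₁)
    (hs : (X \ B₂).encard ≤ k ∨ ((B₁ \ B₂) \ X).encard ≤ l) :
    M.IsBase ((B₁ \ X) ∪ σ '' X) := by
  have hfix := h.eq_self
  have key := h.isBase (X \ B₂) (sdiff_subset_sdiff_left hX) (by
    refine hs.imp_right fun h' => ?_
    rwa [show (B₁ \ B₂) \ (X \ B₂) = (B₁ \ B₂) \ X by grind])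
  convert key using 1
  ext y
  constructor
  · rintro (⟨hy, hyX⟩ | ⟨x, hx, rfl⟩)
    · exact Or.inl ⟨hy, fun h' => hyX h'.1⟩
    · by_cases hxB : x ∈ B₂
      · rw [hfix x (hX hx) hxB]
        exact Or.inl ⟨hX hx, fun h' => h'.2 hxB⟩
      · exact Or.inr ⟨x, ⟨hx, hxB⟩, rfl⟩
  · rintro (⟨hy, hyX⟩ | ⟨x, hx, rfl⟩)
    · by_cases hyX' : y ∈ X
      · have : y ∈ B₂ := by by_contra h'; exact hyX ⟨hyX', h'⟩
        exact Or.inr ⟨y, hyX', hfix y hy this⟩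
      · exact Or.inl ⟨hy, hyX'⟩
    · exact Or.inr ⟨x, hx.1, rfl⟩

theorem isBase_of_indep_of_eRank_le {M : Matroid α} [M.RankFinite] {I : Set α} (hI : M.Indep I)
    (h : M.eRank ≤ I.encard) : M.IsBase I := by
  obtain ⟨B, hB, hIB⟩ := hI.exists_isBase_superset
  have hle : B.encard ≤ I.encard := hB.encard_eq_eRank.trans_le h
  rwa [(hB.finite.subset hIB).eq_of_subset_of_encard_le hIB hle]

theorem klBaseOrderable_of_exchange {k l : ℕ} {M : Matroid α} [hM : M.Finite]
    (h : ∀ B₁ B₂, M.IsBase B₁ → M.IsBase B₂ → ∃ σ, IsExchangeMap M k l B₁ B₂ σ) :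
    KLBaseOrderable k l M := by
  refine ⟨hM, fun B₁ B₂ h₁ h₂ => ?_⟩
  obtain ⟨σ, hσ⟩ := h B₁ B₂ h₁ h₂
  refine ⟨hσ.bijOn.equiv, fun X hX => ?_⟩
  have hXB : Subtype.val '' X ⊆ B₁ := by rintro _ ⟨x, -, rfl⟩; exact x.2
  have him : Subtype.val '' (hσ.bijOn.equiv '' X) = σ '' (Subtype.val '' X) := by
    rw [image_image, image_image]
    rfl
  rw [him]
  refine hσ.isBase_of_subset hXB (hX.imp (fun h' => ?_) fun h' => ?_)
  · exact (encard_le_encard sdiff_subset).trans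
      ((Subtype.val_injective.encard_image X).trans_le h')
  · rw [← h₁.encard_eq_eRank, ← Subtype.val_injective.encard_image X,
      ← encard_sdiff_add_encard_of_subset hXB, add_comm] at h'
    have hfin : (Subtype.val '' X).encard ≠ ⊤ := (h₁.finite.subset hXB).encard_lt_top.ne
    refine le_trans (encard_le_encard ?_) ((ENat.add_le_add_iff_left hfin).1 h')
    exact sdiff_subset_sdiff_left sdiff_subset

-- The bijection supplied by the definition already fixes B₁ ∩ B₂; this is where k + l > 0 enters.
open Classical in
theorem KLBaseOrderable.exists_exchange {k l : ℕ} (hkl : 0 < k + l) {M : Matroid α}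
    (hM : KLBaseOrderable k l M) {B₁ B₂ : Set α} (h₁ : M.IsBase B₁) (h₂ : M.IsBase B₂) :
    ∃ σ, IsExchangeMap M k l B₁ B₂ σ := by
  have := hM.1
  obtain ⟨e, he⟩ := hM.2 B₁ B₂ h₁ h₂
  set σ : α → α := fun x => if h : x ∈ B₁ then e ⟨x, h⟩ else x with hσdef
  have hσ : ∀ x : B₁, σ x = e x := fun x => by simp [hσdef]
  have hbij : BijOn σ B₁ B₂ := by
    refine ⟨fun x hx => ?_, fun x hx y hy hxy => ?_, fun y hy => ?_⟩
    · rw [hσ ⟨x, hx⟩]; exact (e _).2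
    · rw [hσ ⟨x, hx⟩, hσ ⟨y, hy⟩] at hxy
      simpa using e.injective (Subtype.ext hxy)
    · exact ⟨e.symm ⟨y, hy⟩, (e.symm ⟨y, hy⟩).2, by rw [hσ]; simp⟩
  have hbase : ∀ X ⊆ B₁, (X.encard ≤ k ∨ (B₁ \ X).encard ≤ l) →
      M.IsBase ((B₁ \ X) ∪ σ '' X) := by
    intro X hX hs
    have hval : Subtype.val '' (Subtype.val ⁻¹' X : Set B₁) = X := by
      rw [Subtype.image_preimage_coe, inter_eq_right.2 hX]
    have him : Subtype.val '' (e '' (Subtype.val ⁻¹' X : Set B₁)) = σ '' X := by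
      conv_rhs => rw [← hval]
      rw [image_image, image_image]
      exact image_congr fun x _ => (hσ x).symm
    have := he (Subtype.val ⁻¹' X)
    rw [him, hval, ← Subtype.val_injective.encard_image, hval] at this
    refine this (hs.imp_right fun h' => ?_)
    rw [← h₁.encard_eq_eRank, ← encard_sdiff_add_encard_of_subset hX, add_comm]
    gcongr
  have hfix : ∀ x ∈ B₁, x ∈ B₂ → σ x = x := by
    intro x hx₁ hx₂
    by_contra hne
    rcases Nat.eq_zero_or_pos k with hk | hk
    · have hl : 1 ≤ l := by omega
      -- Keeping only x and exchanging the rest gives a subset of B₂ that misses σ x.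
      have hB := hbase (B₁ \ {x}) sdiff_subset (Or.inr (by
        rw [sdiff_sdiff_cancel_left (singleton_subset_iff.2 hx₁), encard_singleton]
        exact_mod_cast hl))
      refine h₂.not_isBase_of_ssubset ?_ hB
      rw [sdiff_sdiff_cancel_left (singleton_subset_iff.2 hx₁)]
      refine ⟨union_subset (singleton_subset_iff.2 hx₂)
        ((image_mono sdiff_subset).trans hbij.image_eq.subset), fun hsub => ?_⟩
      rcases hsub (hbij.mapsTo hx₁) with h' | ⟨z, hz, hzx⟩
      · exact hne h'
      · exact hz.2 (hbij.injOn hz.1 hx₁ hzx)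
    · obtain ⟨y, hy, hyx⟩ := hbij.surjOn hx₂
      have hyne : x ≠ y := by rintro rfl; exact hne hyx
      -- Exchanging only the preimage y of x gives B₁ \ {y}, because x is already in B₁.
      have hB := hbase {y} (singleton_subset_iff.2 hy) (Or.inl (by
        rw [encard_singleton]; exact_mod_cast hk))
      refine h₁.not_isBase_of_ssubset ?_ hB
      rw [image_singleton, hyx]
      refine ⟨union_subset sdiff_subset (singleton_subset_iff.2 hx₁), fun hsub => ?_⟩
      rcases hsub hy with h' | h'
      · exact h'.2 rfl
      · exact hyne h'.symm
  refine ⟨σ, hbij, hfix, fun X hX hs => ?_⟩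
  rcases hs with hs | hs
  · exact hbase X (hX.trans sdiff_subset) (Or.inl hs)
  -- Adding the fixed set B₁ ∩ B₂ to X does not alter the exchange, and the complement in B₁ becomes
  -- (B₁ \ B₂) \ X.
  · have := hbase (X ∪ (B₁ ∩ B₂)) (union_subset (hX.trans sdiff_subset) inter_subset_left)
      (Or.inr (by rwa [show B₁ \ (X ∪ (B₁ ∩ B₂)) = (B₁ \ B₂) \ X by grind]))
    have him : σ '' (B₁ ∩ B₂) = B₁ ∩ B₂ := by
      conv_rhs => rw [← image_id (B₁ ∩ B₂)]
      exact image_congr fun x hx => hfix x hx.1 hx.2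
    rw [image_union, him] at this
    convert this using 1
    ext y
    have : y ∈ X → y ∉ B₂ := fun h' => (hX h').2
    simp only [mem_union, mem_sdiff, mem_inter_iff]
    tauto

/-- With τ the inverse of σ, exchanging X from B₂ gives the same set as exchanging (B₁ \ B₂) \ τ(X)
from B₁, so k and l trade places. -/
theorem IsExchangeMap.exists_symm {M : Matroid α} {k l : ℕ} {B₁ B₂ : Set α} {σ : α → α}
    (h : IsExchangeMap M k l B₁ B₂ σ) : ∃ τ, IsExchangeMap M l k B₂ B₁ τ := by
  -- `Function.invFunOn` needs a nonempty type.
  rcases isEmpty_or_nonempty α with hα | hα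
  · refine ⟨σ, ?_⟩
    have h0 : ∀ s t : Set α, s = t := fun s t => Subsingleton.elim _ _
    refine ⟨h0 B₁ B₂ ▸ h.bijOn, fun x => hα.elim x, fun X _ _ => ?_⟩
    have := h.isBase ∅ (empty_subset _) (Or.inl (by simp))
    rwa [h0 (B₂ \ X ∪ σ '' X) (B₁ \ ∅ ∪ σ '' ∅)]
  have hinv := h.bijOn.invOn_invFunOn
  have hb := BijOn.symm hinv.symm h.bijOn
  set τ := Function.invFunOn σ B₁
  have hfix : ∀ x ∈ B₂, x ∈ B₁ → τ x = x := fun x h₂ h₁ => by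
    conv_lhs => rw [← h.eq_self x h₁ h₂]
    exact hinv.1 h₁
  refine ⟨τ, hb, hfix, fun X hX hs => ?_⟩
  have hXB : X ⊆ B₂ := hX.trans sdiff_subset
  have hsub : τ '' X ⊆ B₁ \ B₂ := by
    rintro _ ⟨x, hx, rfl⟩
    refine ⟨hb.mapsTo (hXB hx), fun h' => (hX hx).2 ?_⟩
    rw [← hinv.2 (hXB hx), h.eq_self _ (hb.mapsTo (hXB hx)) h']
    exact hb.mapsTo (hXB hx)
  have hcard : ((B₁ \ B₂) \ ((B₁ \ B₂) \ τ '' X)).encard = X.encard := by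
    rw [sdiff_sdiff_cancel_left hsub]
    exact (hb.injOn.mono hXB).encard_image
  have himg : σ '' ((B₁ \ B₂) \ τ '' X) = (B₂ \ B₁) \ X := by
    ext y
    constructor
    · rintro ⟨x, ⟨⟨hx₁, hx₂⟩, hxX⟩, rfl⟩
      refine ⟨⟨h.bijOn.mapsTo hx₁, fun h' => hx₂ ?_⟩, fun h' => hxX ⟨_, h', hinv.1 hx₁⟩⟩
      have := h.bijOn.injOn h' hx₁ (h.eq_self _ h' (h.bijOn.mapsTo hx₁))
      exact this ▸ h.bijOn.mapsTo hx₁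
    · rintro ⟨⟨hy₂, hy₁⟩, hyX⟩
      refine ⟨τ y, ⟨⟨hb.mapsTo hy₂, fun h' => hy₁ ?_⟩, ?_⟩, hinv.2 hy₂⟩
      · rw [← hinv.2 hy₂, h.eq_self _ (hb.mapsTo hy₂) h']
        exact hb.mapsTo hy₂
      · rintro ⟨z, hz, hzy⟩
        exact hyX (hb.injOn (hXB hz) hy₂ hzy ▸ hz)
  have hcard' : ((B₁ \ B₂) \ τ '' X).encard = ((B₂ \ B₁) \ X).encard := by
    rw [← himg]
    exact ((h.bijOn.injOn.mono (sdiff_subset.trans sdiff_subset)).encard_image).symm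
  have := h.isBase ((B₁ \ B₂) \ τ '' X) sdiff_subset (by
    rw [hcard, hcard']; exact hs.symm)
  rw [himg] at this
  convert this using 1
  have := hb.mapsTo
  grind

/-! ### Duals, minors and direct sums -/

-- Let σ be the inverse of an exchange map between the complements. Then (B₁ \ X) ∪ σ(X) is the
-- complement of the set obtained from E \ B₂ by exchanging (B₁ \ B₂) \ X. Inverting interchanges k
-- and l, and complementing X restores them.
open Classical in
theorem KLBaseOrderable.dual {k l : ℕ} (hkl : 0 < k + l) {M : Matroid α}
    (hM : KLBaseOrderable k l M) : KLBaseOrderable k l M✶ := by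
  have := hM.1
  refine klBaseOrderable_of_exchange fun B₁ B₂ h₁ h₂ => ?_
  have hE₁ : B₁ ⊆ M.E := h₁.subset_ground
  have hE₂ : B₂ ⊆ M.E := h₂.subset_ground
  obtain ⟨ρ, hρ⟩ := hM.exists_exchange hkl h₁.compl_isBase_of_dual h₂.compl_isBase_of_dual
  obtain ⟨σ, hσ⟩ := hρ.exists_symm
  have hmaps : ∀ x ∈ B₁, x ∉ B₂ → σ x ∈ B₂ ∧ σ x ∉ B₁ := by
    intro x hx₁ hx₂
    have hx := hσ.bijOn.mapsTo ⟨hE₁ hx₁, hx₂⟩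
    refine ⟨by_contra fun h' => ?_, hx.2⟩
    have := hσ.bijOn.injOn ⟨hx.1, h'⟩ ⟨hE₁ hx₁, hx₂⟩ (hσ.eq_self _ ⟨hx.1, h'⟩ hx)
    exact hx.2 (by rwa [this])
  refine ⟨fun x => if x ∈ B₂ then x else σ x, ⟨fun x hx => ?_, fun x hx y hy hxy => ?_,
    fun y hy => ?_⟩, fun x _ hx => if_pos hx, fun X hX hs => ?_⟩
  · by_cases h : x ∈ B₂
    · simp [h]
    · simpa [h] using (hmaps x hx h).1
  · by_cases hx' : x ∈ B₂ <;> by_cases hy' : y ∈ B₂ <;>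
      simp only [hx', hy', if_true, if_false] at hxy
    · exact hxy
    · exact absurd (hxy ▸ hx) (hmaps y hy hy').2
    · exact absurd (hxy ▸ hy) (hmaps x hx hx').2
    · exact hσ.bijOn.injOn ⟨hE₁ hx, hx'⟩ ⟨hE₁ hy, hy'⟩ hxy
  · by_cases h : y ∈ B₁
    · exact ⟨y, h, by simp [hy]⟩
    · obtain ⟨x, hx, hxy⟩ := hσ.bijOn.surjOn ⟨hE₂ hy, h⟩
      have hxB : x ∈ B₁ := by
        by_contra h'
        rw [hσ.eq_self x hx ⟨hx.1, h'⟩] at hxy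
        exact hx.2 (hxy ▸ hy)
      exact ⟨x, hxB, by simpa [hx.2] using hxy⟩
  · have hd : (M.E \ B₂) \ (M.E \ B₁) = B₁ \ B₂ := by
      ext x; have := @hE₁ x; simp only [mem_sdiff]; tauto
    have hb := hσ.isBase ((B₁ \ B₂) \ X) (by rw [hd]; exact sdiff_subset) (by
      rw [hd, sdiff_sdiff_cancel_left hX]; exact hs.symm)
    have him : (fun x => if x ∈ B₂ then x else σ x) '' X = σ '' X :=
      image_congr fun x hx => if_neg (hX hx).2
    rw [him, Matroid.dual_isBase_iff']
    have hXs : ∀ x ∈ X, x ∈ B₁ ∧ x ∉ B₂ := fun x hx => hX hx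
    refine ⟨?_, union_subset (sdiff_subset.trans hE₁) ?_⟩
    · convert hb using 1
      ext y
      simp only [mem_sdiff, mem_union, not_or, not_and, not_not]
      constructor
      · rintro ⟨hyE, hyX, hyσ⟩
        by_cases hy₁ : y ∈ B₁
        · have := hXs y (hyX hy₁)
          exact Or.inl ⟨⟨hyE, this.2⟩, fun _ => hyX hy₁⟩
        · by_cases hy₂ : y ∈ B₂
          · obtain ⟨x, hx, hxy⟩ := hσ.bijOn.surjOn ⟨hyE, hy₁⟩
            have hxB : x ∈ B₁ := by
              by_contra h'
              rw [hσ.eq_self x hx ⟨hx.1, h'⟩] at hxy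
              exact hx.2 (hxy ▸ hy₂)
            exact Or.inr ⟨x, ⟨⟨hxB, hx.2⟩, fun h' => hyσ ⟨x, h', hxy⟩⟩, hxy⟩
          · exact Or.inl ⟨⟨hyE, hy₂⟩, fun h' => absurd h'.1 hy₁⟩
      · rintro (⟨⟨hyE, hy₂⟩, h⟩ | ⟨x, ⟨⟨hx₁, hx₂⟩, hxX⟩, rfl⟩)
        · refine ⟨hyE, fun h' => h ⟨h', hy₂⟩, ?_⟩
          rintro ⟨x, hx, rfl⟩
          exact hy₂ (hmaps x (hXs x hx).1 (hXs x hx).2).1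
        · have hm := hmaps x hx₁ hx₂
          refine ⟨hE₂ hm.1, fun h' => absurd h' hm.2, ?_⟩
          rintro ⟨z, hz, hzx⟩
          exact hxX (hσ.bijOn.injOn ⟨hE₁ (hXs z hz).1, (hXs z hz).2⟩ ⟨hE₁ hx₁, hx₂⟩ hzx ▸ hz)
    · rintro _ ⟨x, hx, rfl⟩
      exact hE₂ (hmaps x (hXs x hx).1 (hXs x hx).2).1

/-- I and J have the same closure, so J ∪ Z spans, and it has the size of a base. -/
theorem isBase_union_of_isBasis {M : Matroid α} [M.RankFinite] {I J Z R : Set α}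
    (hI : M.IsBasis I R) (hJ : M.IsBasis J R) (hZ : Disjoint Z R) (hb : M.IsBase (I ∪ Z)) :
    M.IsBase (J ∪ Z) := by
  have hs : M.Spanning (J ∪ Z) := by
    rw [Matroid.spanning_iff_closure_eq (union_subset hJ.indep.subset_ground
      (subset_union_right.trans hb.subset_ground)),
      M.closure_union_congr_left (hJ.closure_eq_closure.trans hI.closure_eq_closure.symm)]
    exact hb.closure_eq
  obtain ⟨B, hB, hBs⟩ := hs.exists_isBase_subset
  have hle : (J ∪ Z).encard ≤ B.encard := by
    rw [hB.encard_eq_encard_of_isBase hb, encard_union_eq (hZ.mono_right hJ.subset).symm,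
      encard_union_eq (hZ.mono_right hI.subset).symm, hI.encard_eq_encard hJ]
  rwa [← hB.finite.eq_of_subset_of_encard_le hBs hle]

-- Both bases are completed to bases of M by the same set Z outside R. Since σ fixes Z pointwise it
-- maps B₁ onto B₂, and removing Z from an exchanged base leaves an independent subset of R of full
-- size.
open Classical in
theorem KLBaseOrderable.restrict {k l : ℕ} (hkl : 0 < k + l) {M : Matroid α}
    (hM : KLBaseOrderable k l M) {R : Set α} (hR : R ⊆ M.E) : KLBaseOrderable k l (M ↾ R) := by
  have hfin := hM.1
  have : (M ↾ R).Finite := ⟨M.ground_finite.subset hR⟩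
  refine klBaseOrderable_of_exchange fun B₁ B₂ h₁ h₂ => ?_
  rw [Matroid.isBase_restrict_iff hR] at h₁ h₂
  obtain ⟨B, hB, hBR⟩ := h₁.exists_isBase
  have hdZ : Disjoint (B \ R) R := disjoint_sdiff_left
  have hb₁ : M.IsBase (B₁ ∪ (B \ R)) := by rwa [hBR, inter_union_sdiff]
  have hb₂ := isBase_union_of_isBasis h₁ h₂ hdZ hb₁
  obtain ⟨σ, hσ⟩ := hM.exists_exchange hkl hb₁ hb₂
  generalize B \ R = Z at *
  have hZ : ∀ x ∈ Z, x ∉ R := fun x hx hxR => hdZ.le_bot ⟨hx, hxR⟩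
  have hdiff : (B₁ ∪ Z) \ (B₂ ∪ Z) = B₁ \ B₂ := by
    ext x
    have := hZ x
    have : x ∈ B₁ → x ∈ R := fun h => h₁.subset h
    simp only [mem_sdiff, mem_union]
    tauto
  have hmaps : ∀ x ∈ B₁, σ x ∈ B₂ := by
    intro x hx
    rcases hσ.bijOn.mapsTo (Or.inl hx) with h | h
    · exact h
    · have := hσ.bijOn.injOn (Or.inr h) (Or.inl hx) (hσ.eq_self _ (Or.inr h) (Or.inr h))
      exact absurd (h₁.subset hx) (hZ _ (this ▸ h))
  refine ⟨σ, ⟨hmaps, hσ.bijOn.injOn.mono subset_union_left, fun y hy => ?_⟩,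
    fun x hx₁ hx₂ => hσ.eq_self x (Or.inl hx₁) (Or.inl hx₂), fun X hX hs => ?_⟩
  · obtain ⟨x, hx | hx, rfl⟩ := hσ.bijOn.surjOn (Or.inl hy)
    · exact ⟨x, hx, rfl⟩
    · rw [hσ.eq_self x (Or.inr hx) (Or.inr hx)] at hy
      exact absurd (h₂.subset hy) (hZ x hx)
  · have hb := hσ.isBase X (by rwa [hdiff]) (by rwa [hdiff])
    have hXR : B₁ \ X ∪ σ '' X ⊆ R := by
      refine union_subset (sdiff_subset.trans h₁.subset) ?_
      rintro _ ⟨x, hx, rfl⟩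
      exact h₂.subset (hmaps x (hX hx).1)
    have heq : (B₁ ∪ Z) \ X ∪ σ '' X = (B₁ \ X ∪ σ '' X) ∪ Z := by
      ext x
      have h1 := hZ x
      have h2 : x ∈ X → x ∈ R := fun h => h₁.subset (hX h).1
      simp only [mem_sdiff, mem_union]
      tauto
    rw [heq] at hb
    have hcard : B₁.encard = (B₁ \ X ∪ σ '' X).encard := by
      have hc := hb₁.encard_eq_encard_of_isBase hb
      rw [encard_union_eq (hdZ.mono_right h₁.subset).symm,
        encard_union_eq (hdZ.mono_right hXR).symm] at hc
      exact WithTop.add_right_cancel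
        (hb.finite.subset subset_union_right).encard_lt_top.ne hc
    refine isBase_of_indep_of_eRank_le
      (Matroid.restrict_indep_iff.2 ⟨hb.indep.subset subset_union_left, hXR⟩) ?_
    rw [← hcard, ((Matroid.isBase_restrict_iff hR).2 h₁).encard_eq_eRank]

theorem KLBaseOrderable.delete {k l : ℕ} (hkl : 0 < k + l) {M : Matroid α}
    (hM : KLBaseOrderable k l M) (D : Set α) : KLBaseOrderable k l (M ＼ D) := by
  rw [Matroid.delete_eq_restrict]
  exact hM.restrict hkl sdiff_subset

theorem KLBaseOrderable.minor {k l : ℕ} (hkl : 0 < k + l) {M N : Matroid α}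
    (hM : KLBaseOrderable k l M) (hN : N ≤m M) : KLBaseOrderable k l N := by
  obtain ⟨C, D, rfl⟩ := hN
  rw [← Matroid.dual_delete_dual]
  exact (((hM.dual hkl).delete hkl C).dual hkl).delete hkl D

/-- The two exchange maps act side by side: |X| and |(B₁ \ B₂) \ X| can only drop on passing to one
summand, so whichever bound holds is inherited by both. -/
theorem KLBaseOrderable.sum {k l : ℕ} (hkl : 0 < k + l) {M : Matroid α} {N : Matroid β}
    (hM : KLBaseOrderable k l M) (hN : KLBaseOrderable k l N) :
    KLBaseOrderable k l (M.sum N) := by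
  have hMf := hM.1
  have hNf := hN.1
  have : (M.sum N).Finite := ⟨by
    rw [Matroid.sum_ground]
    exact (M.ground_finite.image _).union (N.ground_finite.image _)⟩
  refine klBaseOrderable_of_exchange fun B₁ B₂ h₁ h₂ => ?_
  rw [Matroid.sum_isBase_iff] at h₁ h₂
  obtain ⟨σ, hσ⟩ := hM.exists_exchange hkl h₁.1 h₂.1
  obtain ⟨τ, hτ⟩ := hN.exists_exchange hkl h₁.2 h₂.2
  refine ⟨Sum.map σ τ, ⟨?_, ?_, ?_⟩, ?_, fun X hX hs => ?_⟩
  · rintro (x | x) hx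
    · exact hσ.bijOn.mapsTo hx
    · exact hτ.bijOn.mapsTo hx
  · rintro (x | x) hx (y | y) hy hxy
    · exact congrArg _ (hσ.bijOn.injOn hx hy (Sum.inl_injective hxy))
    · simp at hxy
    · simp at hxy
    · exact congrArg _ (hτ.bijOn.injOn hx hy (Sum.inr_injective hxy))
  · rintro (y | y) hy
    · obtain ⟨x, hx, rfl⟩ := hσ.bijOn.surjOn hy
      exact ⟨Sum.inl x, hx, rfl⟩
    · obtain ⟨x, hx, rfl⟩ := hτ.bijOn.surjOn hy
      exact ⟨Sum.inr x, hx, rfl⟩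
  · rintro (x | x) hx₁ hx₂
    · exact congrArg Sum.inl (hσ.eq_self x hx₁ hx₂)
    · exact congrArg Sum.inr (hτ.eq_self x hx₁ hx₂)
  · have hleft : ∀ S : Set (α ⊕ β), (Sum.inl ⁻¹' S).encard ≤ S.encard := fun S => by
      rw [← Sum.inl_injective.encard_image]
      exact encard_le_encard (image_preimage_subset _ _)
    have hright : ∀ S : Set (α ⊕ β), (Sum.inr ⁻¹' S).encard ≤ S.encard := fun S => by
      rw [← Sum.inr_injective.encard_image]
      exact encard_le_encard (image_preimage_subset _ _)
    rw [Matroid.sum_isBase_iff]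
    have h1 := hσ.isBase (Sum.inl ⁻¹' X) (preimage_mono hX)
      (hs.imp (hleft _).trans (hleft _).trans)
    have h2 := hτ.isBase (Sum.inr ⁻¹' X) (preimage_mono hX)
      (hs.imp (hright _).trans (hright _).trans)
    constructor
    · convert h1 using 1
      ext x
      simp
    · convert h2 using 1
      ext x
      simp

/-! ### Relabelling and isomorphism -/

open Classical in
theorem KLBaseOrderable.map {k l : ℕ} (hkl : 0 < k + l) {M : Matroid α}
    (hM : KLBaseOrderable k l M) {φ : α → β} (hφ : φ.Injective) :
    KLBaseOrderable k l (M.map φ hφ.injOn) := by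
  have hMf := hM.1
  have : (M.map φ hφ.injOn).Finite := ⟨M.ground_finite.image φ⟩
  refine klBaseOrderable_of_exchange fun B₁' B₂' h₁ h₂ => ?_
  rw [Matroid.map_isBase_iff] at h₁ h₂
  obtain ⟨B₁, h₁, rfl⟩ := h₁
  obtain ⟨B₂, h₂, rfl⟩ := h₂
  obtain ⟨σ, hσ⟩ := hM.exists_exchange hkl h₁ h₂
  have hext : ∀ x, Function.extend φ (φ ∘ σ) id (φ x) = φ (σ x) := fun x =>
    hφ.extend_apply _ _ _
  refine ⟨Function.extend φ (φ ∘ σ) id, ⟨?_, ?_, ?_⟩, ?_, fun X hX hs => ?_⟩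
  · rintro _ ⟨x, hx, rfl⟩
    rw [hext]
    exact mem_image_of_mem φ (hσ.bijOn.mapsTo hx)
  · rintro _ ⟨x, hx, rfl⟩ _ ⟨y, hy, rfl⟩ hxy
    rw [hext, hext] at hxy
    rw [hσ.bijOn.injOn hx hy (hφ hxy)]
  · rintro _ ⟨y, hy, rfl⟩
    obtain ⟨x, hx, rfl⟩ := hσ.bijOn.surjOn hy
    exact ⟨φ x, mem_image_of_mem φ hx, hext x⟩
  · rintro _ ⟨x, hx, rfl⟩ hx₂
    rw [hext, hσ.eq_self x hx (hφ.mem_set_image.1 hx₂)]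
  · rw [← image_sdiff hφ] at hX hs
    obtain ⟨X, hX', rfl⟩ := subset_image_iff.1 hX
    rw [← image_sdiff hφ, hφ.encard_image, hφ.encard_image] at hs
    rw [Matroid.map_isBase_iff]
    refine ⟨_, hσ.isBase X hX' hs, ?_⟩
    rw [image_union, image_sdiff hφ, image_image, image_image]
    simp only [hext]

theorem KLBaseOrderable.of_map {k l : ℕ} (hkl : 0 < k + l) {M : Matroid α} {φ : α → β}
    (hφ : φ.Injective) (hM : KLBaseOrderable k l (M.map φ hφ.injOn)) :
    KLBaseOrderable k l M := by
  have : M.Finite := ⟨Set.Finite.of_finite_image hM.1.ground_finite hφ.injOn⟩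
  refine klBaseOrderable_of_exchange fun B₁ B₂ h₁ h₂ => ?_
  rcases isEmpty_or_nonempty α with hα | hα
  · have h0 : ∀ s t : Set α, s = t := fun s t => Subsingleton.elim _ _
    exact ⟨id, by rw [h0 B₁ B₂]; exact bijOn_id _, fun x => hα.elim x, fun X _ _ => by
      rwa [h0 (B₁ \ X ∪ id '' X) B₁]⟩
  obtain ⟨σ, hσ⟩ := hM.exists_exchange hkl (h₁.map hφ.injOn) (h₂.map hφ.injOn)
  have hinv : ∀ x ∈ B₁, φ (Function.invFun φ (σ (φ x))) = σ (φ x) := fun x hx => by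
    obtain ⟨y, -, hy⟩ := hσ.bijOn.mapsTo (mem_image_of_mem φ hx)
    exact Function.invFun_eq ⟨y, hy⟩
  refine ⟨fun x => Function.invFun φ (σ (φ x)), ⟨fun x hx => ?_, fun x hx y hy hxy => ?_,
    fun y hy => ?_⟩, fun x hx₁ hx₂ => ?_, fun X hX hs => ?_⟩
  · have := hσ.bijOn.mapsTo (mem_image_of_mem φ hx)
    rwa [← hinv x hx, hφ.mem_set_image] at this
  · have h := congrArg φ hxy
    simp only [hinv x hx, hinv y hy] at h
    exact hφ (hσ.bijOn.injOn (mem_image_of_mem φ hx) (mem_image_of_mem φ hy) h)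
  · obtain ⟨_, ⟨x, hx, rfl⟩, hxy⟩ := hσ.bijOn.surjOn (mem_image_of_mem φ hy)
    exact ⟨x, hx, hφ (by rw [hinv x hx, hxy])⟩
  · exact hφ (by rw [hinv x hx₁, hσ.eq_self _ (mem_image_of_mem φ hx₁) (mem_image_of_mem φ hx₂)])
  · have hb := hσ.isBase (φ '' X) (by rw [← image_sdiff hφ]; exact image_mono hX) (by
      rwa [← image_sdiff hφ, ← image_sdiff hφ, hφ.encard_image, hφ.encard_image])
    have him : σ '' (φ '' X) = φ '' ((fun x => Function.invFun φ (σ (φ x))) '' X) := by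
      rw [image_image, image_image]
      exact image_congr fun x hx => (hinv x (hX hx).1).symm
    rw [him, ← image_sdiff hφ, ← image_union, Matroid.map_isBase_iff] at hb
    obtain ⟨B, hB, hBeq⟩ := hb
    rwa [hφ.image_injective hBeq]

theorem KLBaseOrderable.iso {k l : ℕ} (hkl : 0 < k + l) {M : Matroid α} {N : Matroid β}
    (hM : KLBaseOrderable k l M) (h : Isomorphic M N) : KLBaseOrderable k l N := by
  obtain ⟨e, he⟩ := h
  have hM' : KLBaseOrderable k l (M.restrictSubtype M.E) := by
    refine KLBaseOrderable.of_map hkl Subtype.val_injective ?_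
    rwa [Matroid.map_val_restrictSubtype_ground_eq]
  have hN : N.restrictSubtype N.E = (M.restrictSubtype M.E).map e e.injective.injOn := by
    refine Matroid.ext_indep (by simp) fun I _ => ?_
    rw [Matroid.map_indep_iff, Matroid.restrictSubtype_indep_iff]
    constructor
    · intro hI
      refine ⟨e.symm '' I, ?_, (e.image_symm_image I).symm⟩
      rw [Matroid.restrictSubtype_indep_iff, he, e.image_symm_image]
      exact hI
    · rintro ⟨J, hJ, rfl⟩
      exact (he J).1 (Matroid.restrictSubtype_indep_iff.1 hJ)
  rw [← Matroid.map_val_restrictSubtype_ground_eq N]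
  have := (hM'.map hkl e.injective).map hkl (Subtype.val_injective (p := (· ∈ N.E)))
  rw [← hN] at this
  exact this

/-! ### Exchange maps after deleting one element from each base -/

/-- T is one element short of a base, so it can be augmented from B, and B \ T ⊆ {f, g}. -/
theorem exists_insert_isBase {M : Matroid α} [M.RankFinite] {T B : Set α} {x f g : α}
    (hx : x ∉ T) (hT : M.IsBase (insert x T)) (hB : M.IsBase B) (hBT : B ⊆ insert f (insert g T)) :
    ∃ h, (h = f ∨ h = g) ∧ h ∉ T ∧ M.IsBase (insert h T) := by
  have hTi : M.Indep T := hT.indep.subset (subset_insert _ _)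
  have hcard := hB.encard_eq_encard_of_isBase hT
  rw [encard_insert_of_notMem hx] at hcard
  have hlt : T.encard < B.encard := by
    rw [hcard]
    exact ENat.lt_add_one_iff (hT.finite.subset (subset_insert _ _)).encard_lt_top.ne |>.2 le_rfl
  obtain ⟨h, ⟨hhB, hhT⟩, hh⟩ := hTi.augment hB.indep hlt
  refine ⟨h, ?_, hhT, isBase_of_indep_of_eRank_le hh ?_⟩
  · rcases hBT hhB with h' | h' | h'
    · exact Or.inl h'
    · exact Or.inr h'
    · exact absurd h' hhT
  · rw [encard_insert_of_notMem hhT, ← hcard, hB.encard_eq_eRank]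

section SetIdentities

variable {A I X S : Set α} {a b f g : α}

theorem insert_sdiff_insert_union_insert (hf : f ∉ I) :
    insert f I \ insert f X ∪ insert b S = insert b (I \ X ∪ S) := by
  ext y
  have : y ∈ I → y ≠ f := fun h h' => hf (h' ▸ h)
  simp only [mem_insert_iff, mem_union, mem_sdiff]
  tauto

theorem insert_sdiff_insert_union_insert_of_mem (hf : f ∉ I) (ha : a ∈ I) (haX : a ∉ X) :
    insert f I \ insert f X ∪ insert b S = insert a (I \ insert a X ∪ insert b S) := by
  rw [insert_sdiff_insert_union_insert hf]
  ext y
  have : y = a → y ∈ I ∧ y ∉ X := fun h => h ▸ ⟨ha, haX⟩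
  simp only [mem_insert_iff, mem_union, mem_sdiff]
  tauto

theorem insert_union_insert_subset :
    insert f (A ∪ insert g S) ⊆ insert f (insert g (A ∪ insert b S)) := by
  intro y
  simp only [mem_insert_iff, mem_union]
  tauto

theorem insert_union_insert_comm :
    insert b (A ∪ insert g S) = insert g (A ∪ insert b S) := by
  ext y
  simp only [mem_insert_iff, mem_union]
  tauto

theorem insert_sdiff_insert_union_insert_subset :
    insert f I \ insert a X ∪ insert g S ⊆ insert f (insert g (I \ X ∪ S)) := by
  intro y
  simp only [mem_insert_iff, mem_union, mem_sdiff]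
  tauto

end SetIdentities

-- If σ f = g, take τ = σ. Otherwise σ a = g for some a ∈ I, and τ sends a straight to σ f. Write T
-- for (I \ X) ∪ τ(X); when no single exchange by σ gives T + f or T + g, two exchanges do: one
-- shows that T is one short of a base, the other is a base inside T + f + g.
open Classical in
theorem IsExchangeMap.exists_of_insert {M : Matroid α} [M.RankFinite] {k l : ℕ} {I J : Set α}
    {f g : α} {σ : α → α} (hf : f ∉ I) (hg : g ∉ J)
    (hσ : IsExchangeMap M k l (insert f I) (insert g J) σ) :
    ∃ τ : α → α, BijOn τ I J ∧ (∀ x ∈ I, x ∈ J → τ x = x) ∧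
      ∀ X ⊆ I \ J, (X.encard ≤ k ∨ ((I \ J) \ X).encard ≤ l) →
        ∃ h, (h = f ∨ h = g) ∧ h ∉ (I \ X) ∪ τ '' X ∧ M.IsBase (insert h ((I \ X) ∪ τ '' X)) := by
  have hmaps : ∀ x ∈ I, σ x = g ∨ σ x ∈ J := fun x hx => hσ.bijOn.mapsTo (Or.inr hx)
  have hmapf : σ f = g ∨ σ f ∈ J := hσ.bijOn.mapsTo (Or.inl rfl)
  have hinj : ∀ x ∈ I, ∀ y ∈ I, σ x = σ y → x = y := fun x hx y hy =>
    hσ.bijOn.injOn (Or.inr hx) (Or.inr hy)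
  have hinjf : ∀ x ∈ I, σ x ≠ σ f := fun x hx h =>
    hf (hσ.bijOn.injOn (Or.inr hx) (Or.inl rfl) h ▸ hx)
  have hfix : ∀ x ∈ I, (x = g ∨ x ∈ J) → σ x = x := fun x hx h => hσ.eq_self x (Or.inr hx) h
  have hfixf : (f = g ∨ f ∈ J) → σ f = f := fun h => hσ.eq_self f (Or.inl rfl) h
  have hsurj : ∀ y ∈ J, σ f = y ∨ ∃ x ∈ I, σ x = y := fun y hy => by
    obtain ⟨x, rfl | hx, hxy⟩ := hσ.bijOn.surjOn (Or.inr hy : y ∈ insert g J)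
    · exact Or.inl hxy
    · exact Or.inr ⟨x, hx, hxy⟩
  have hfim : ∀ x ∈ I, σ x ≠ f := fun x hx h => by
    have h1 := hfixf (h ▸ hmaps x hx)
    exact hinjf x hx (h.trans h1.symm)
  have hk : ∀ S ⊆ insert f I, S.encard ≤ k → M.IsBase (insert f I \ S ∪ σ '' S) := fun S hS h =>
    hσ.isBase_of_subset hS (Or.inl ((encard_le_encard sdiff_subset).trans h))
  have hl : ∀ S ⊆ insert f I, ((insert f I \ insert g J) \ S).encard ≤ l →
      M.IsBase (insert f I \ S ∪ σ '' S) := fun S hS h => hσ.isBase_of_subset hS (Or.inr h)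
  have hlf : ∀ X ⊆ I, ((I \ J) \ X).encard ≤ l →
      M.IsBase (insert (σ f) (I \ X ∪ σ '' X)) := fun X hX h => by
    have := hl (insert f X) (insert_subset_insert hX) 
      ((encard_le_encard (by
        rintro y ⟨⟨rfl | hyI, hyJ⟩, hyX⟩
        · exact absurd (Or.inl rfl) hyX
        · exact ⟨⟨hyI, fun h => hyJ (Or.inr h)⟩, fun h => hyX (Or.inr h)⟩)).trans h)
    rwa [image_insert_eq, insert_sdiff_insert_union_insert hf] at this
  have hkf : ∀ X ⊆ I, X.encard ≤ k → M.IsBase (insert f (I \ X ∪ σ '' X)) := fun X hX h => by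
    convert hk X (hX.trans (subset_insert _ _)) h using 1
    have : f ∉ X := fun h => hf (hX h)
    rw [insert_sdiff_of_notMem _ this, insert_union]
  by_cases hfg : σ f = g
  · refine ⟨σ, ⟨fun x hx => (hmaps x hx).resolve_left fun h => hinjf x hx (h.trans hfg.symm),
      fun x hx y hy => hinj x hx y hy, fun y hy => (hsurj y hy).resolve_left ?_⟩,
      fun x hx hxJ => hfix x hx (Or.inr hxJ), fun X hX hs => ?_⟩
    · rintro rfl
      exact hg (hfg ▸ hy)
    have hXI : X ⊆ I := hX.trans sdiff_subset
    rcases hs with hs | hs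
    · refine ⟨f, Or.inl rfl, ?_, hkf X hXI hs⟩
      rintro (h | ⟨x, hx, hxf⟩)
      · exact hf h.1
      · exact hfim x (hXI hx) hxf
    · refine ⟨g, Or.inr rfl, ?_, hfg ▸ hlf X hXI hs⟩
      rintro (h | ⟨x, hx, hxf⟩)
      · exact hinjf g h.1 ((hfix g h.1 (Or.inl rfl)).trans hfg.symm)
      · exact hinjf x (hXI hx) (hxf.trans hfg.symm)
  obtain ⟨a, ha, hag⟩ : ∃ a ∈ I, σ a = g := by
    obtain ⟨x, rfl | hx, hxy⟩ := hσ.bijOn.surjOn (Or.inl rfl : g ∈ insert g J)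
    · exact absurd hxy hfg
    · exact ⟨x, hx, hxy⟩
  have hfJ : σ f ∈ J := hmapf.resolve_left hfg
  have haJ : a ∉ J := fun h => hg (by rwa [← hag, hfix a ha (Or.inr h)])
  have hfI : σ f ∉ I := fun h => hinjf _ h (hfix _ h (Or.inr hfJ))
  have hτ : ∀ x, x ≠ a → Function.update σ a (σ f) x = σ x := fun x hx =>
    Function.update_of_ne hx _ _
  have hτa : Function.update σ a (σ f) a = σ f := Function.update_self _ _ _
  refine ⟨Function.update σ a (σ f), ⟨fun x hx => ?_, fun x hx y hy hxy => ?_, fun y hy => ?_⟩,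
    fun x hx hxJ => ?_, fun X hX hs => ?_⟩
  · by_cases hxa : x = a
    · rwa [hxa, hτa]
    · rw [hτ x hxa]
      exact (hmaps x hx).resolve_left fun h => hxa (hinj x hx a ha (h.trans hag.symm))
  · by_cases hxa : x = a <;> by_cases hya : y = a
    · exact hxa.trans hya.symm
    · rw [hxa, hτa, hτ y hya] at hxy
      exact absurd hxy.symm (hinjf y hy)
    · rw [hya, hτa, hτ x hxa] at hxy
      exact absurd hxy (hinjf x hx)
    · rw [hτ x hxa, hτ y hya] at hxy
      exact hinj x hx y hy hxy
  · rcases hsurj y hy with rfl | ⟨x, hx, rfl⟩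
    · exact ⟨a, ha, hτa⟩
    · refine ⟨x, hx, hτ x ?_⟩
      rintro rfl
      exact hg (hag ▸ hy)
  · rw [hτ x (fun h => haJ (h ▸ hxJ)), hfix x hx (Or.inr hxJ)]
  have hXI : X ⊆ I := hX.trans sdiff_subset
  by_cases haX : a ∈ X
  · obtain ⟨X₀, haX₀, rfl⟩ : ∃ X₀, a ∉ X₀ ∧ insert a X₀ = X :=
      ⟨X \ {a}, by simp, by simp [haX]⟩
    have hX₀I : X₀ ⊆ I := (subset_insert _ _).trans hXI
    have him : Function.update σ a (σ f) '' insert a X₀ = insert (σ f) (σ '' X₀) := by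
      rw [image_insert_eq, hτa]
      congr 1
      exact image_congr fun x hx => hτ x fun h => haX₀ (h ▸ hx)
    rw [him]
    rcases hs with hs | hs
    · have hcard : (insert f X₀).encard ≤ k := by
        rw [encard_insert_of_notMem haX₀] at hs
        exact (encard_insert_le _ _).trans hs
      -- Exchanging X₀ + f gives the base T + a; exchanging X gives a base inside T + f + g.
      have h1 := hk (insert f X₀) (insert_subset_insert hX₀I) hcard
      have h2 := hkf _ hXI hs
      refine exists_insert_isBase (x := a) ?_ ?_ h2 ?_
      · rintro (h | h | ⟨x, hx, hxa⟩)
        · exact h.2 (Or.inl rfl)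
        · exact haJ (h ▸ hfJ)
        · have h' := hmaps x (hX₀I hx)
          rw [hxa] at h'
          exact haX₀ (hinj x (hX₀I hx) a ha (hxa.trans (hfix a ha h').symm) ▸ hx)
      · rwa [image_insert_eq, insert_sdiff_insert_union_insert_of_mem hf ha haX₀] at h1
      · rw [image_insert_eq, hag]
        exact insert_union_insert_subset
    -- Exchanging X + f gives T + g outright.
    · have h1 := hlf _ hXI hs
      refine exists_insert_isBase (x := g) ?_ ?_ h1 ?_
      · rintro (h | h | ⟨x, hx, hxa⟩)
        · exact h.2 (Or.inl (hinj _ h.1 _ ha ((hfix g h.1 (Or.inl rfl)).trans hag.symm)))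
        · exact hfg h.symm
        · exact haX₀ (hinj x (hX₀I hx) a ha (hxa.trans hag.symm) ▸ hx)
      · rwa [image_insert_eq, hag, insert_union_insert_comm] at h1
      · rw [image_insert_eq, hag, insert_union_insert_comm]
        exact subset_insert _ _
  · have him : Function.update σ a (σ f) '' X = σ '' X :=
      image_congr fun x hx => hτ x fun h => haX (h ▸ hx)
    rw [him]
    rcases hs with hs | hs
    · refine ⟨f, Or.inl rfl, ?_, hkf X hXI hs⟩
      rintro (h | ⟨x, hx, hxf⟩)
      · exact hf h.1
      · exact hfim x (hXI hx) hxf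
    -- Exchanging X + f gives T + σ f; exchanging X + a gives a base inside T + f + g.
    · have h1 := hlf X hXI hs
      have h2 := hl (insert a X) ((insert_subset ha hXI).trans (subset_insert _ _)) (by
        refine le_trans ?_ hs
        -- At most f is newly left unexchanged, and a no longer is, so the bound l survives.
        have hmem : a ∈ (I \ J) \ X := ⟨⟨ha, haJ⟩, haX⟩
        refine (encard_le_encard (t := insert f (((I \ J) \ X) \ {a})) ?_).trans
          ((encard_insert_le _ _).trans (encard_sdiff_singleton_add_one hmem).le)
        rintro y ⟨⟨rfl | hyI, hyJ⟩, hyX⟩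
        · exact Or.inl rfl
        · exact Or.inr ⟨⟨⟨hyI, fun h => hyJ (Or.inr h)⟩, fun h => hyX (Or.inr h)⟩,
            fun h => hyX (Or.inl h)⟩)
      refine exists_insert_isBase (x := σ f) ?_ h1 h2 ?_
      · rintro (h | ⟨x, hx, hxf⟩)
        · exact hfI h.1
        · exact hinjf x (hXI hx) hxf
      · rw [image_insert_eq, hag]
        exact insert_sdiff_insert_union_insert_subset

/-! ### Truncation -/

theorem truncation_indep_iff {M : Matroid α} {r : ℕ} {I : Set α} :
    (truncation M r).Indep I ↔ M.Indep I ∧ I.encard ≤ r := Iff.rfl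

theorem truncation_eq_self {M : Matroid α} {r : ℕ} (h : M.eRank ≤ r) : truncation M r = M :=
  Matroid.ext_indep rfl fun _ _ =>
    ⟨fun hI => hI.1, fun hI => ⟨hI, hI.encard_le_eRank.trans h⟩⟩

theorem truncation_isBase_iff {M : Matroid α} [M.RankFinite] {r : ℕ} (hr : r ≤ M.eRank)
    {B : Set α} : (truncation M r).IsBase B ↔ M.Indep B ∧ B.encard = r := by
  have key : ∀ B, M.Indep B → B.encard = r → (truncation M r).IsBase B := by
    refine fun B hB hBr => Matroid.Indep.isBase_of_maximal ⟨hB, hBr.le⟩ fun J hJ hBJ => ?_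
    have hfin : B.Finite := finite_of_encard_eq_coe hBr
    exact hfin.eq_of_subset_of_encard_le hBJ (hBr ▸ hJ.2)
  refine ⟨fun h => ⟨h.indep.1, ?_⟩, fun h => key B h.1 h.2⟩
  obtain ⟨B', hB'⟩ := M.exists_isBase
  rw [← hB'.encard_eq_eRank] at hr
  obtain ⟨C, hCB, hC⟩ := exists_subset_encard_eq hr
  rw [h.encard_eq_encard_of_isBase (key C (hB'.indep.subset hCB) hC), hC]

/-- Bases of the truncation are extended to bases of M by single elements f and g; the exchanged
sets are then one element short of a base of M, so independent of size r. -/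
theorem KLBaseOrderable.truncation_of_eRank_eq {k l : ℕ} (hkl : 0 < k + l) {M : Matroid α}
    (hM : KLBaseOrderable k l M) {r : ℕ} (hr : M.eRank = r + 1) :
    KLBaseOrderable k l (truncation M r) := by
  have hMf := hM.1
  have : (truncation M r).Finite := ⟨M.ground_finite⟩
  have hr' : (r : ℕ∞) ≤ M.eRank := hr ▸ le_self_add
  have hins : ∀ I h, M.Indep (insert h I) → h ∉ I → I.encard = r → M.IsBase (insert h I) :=
    fun I h hI hh hIr => isBase_of_indep_of_eRank_le hI (by
      rw [encard_insert_of_notMem hh, hr, hIr])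
  have hext : ∀ I, M.Indep I → I.encard = r → ∃ f, f ∉ I ∧ M.IsBase (insert f I) := by
    intro I hI hIr
    obtain ⟨B, hB⟩ := M.exists_isBase
    obtain ⟨f, hf, hfI⟩ := hI.augment hB.indep (by
      rw [hIr, hB.encard_eq_eRank, hr]
      exact_mod_cast Nat.lt_succ_self r)
    exact ⟨f, hf.2, hins I f hfI hf.2 hIr⟩
  refine klBaseOrderable_of_exchange fun I J hI hJ => ?_
  rw [truncation_isBase_iff hr'] at hI hJ
  obtain ⟨f, hf, hfI⟩ := hext I hI.1 hI.2
  obtain ⟨g, hg, hgJ⟩ := hext J hJ.1 hJ.2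
  obtain ⟨σ, hσ⟩ := hM.exists_exchange hkl hfI hgJ
  obtain ⟨τ, hτ, hτfix, hτb⟩ := hσ.exists_of_insert hf hg
  refine ⟨τ, hτ, hτfix, fun X hX hs => ?_⟩
  obtain ⟨h, -, hh, hb⟩ := hτb X hX hs
  rw [truncation_isBase_iff hr']
  refine ⟨hb.indep.subset (subset_insert _ _), ?_⟩
  have hc := hb.encard_eq_eRank
  rw [encard_insert_of_notMem hh, hr] at hc
  exact WithTop.add_right_cancel ENat.one_ne_top hc

theorem KLBaseOrderable.truncation {k l : ℕ} (hkl : 0 < k + l) {M : Matroid α}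
    (hM : KLBaseOrderable k l M) (r : ℕ) : KLBaseOrderable k l (truncation M r) := by
  have hMf := hM.1
  rcases le_total M.eRank r with hle | hle
  · rwa [truncation_eq_self hle]
  -- The rank is lowered one step at a time, and d counts the steps.
  suffices h : ∀ d r : ℕ, M.eRank = r + d →
      KLBaseOrderable k l (CompleteMatroidClass.truncation M r) by
    obtain ⟨d, hd⟩ := exists_add_of_le hle
    have : d ≠ ⊤ := by
      rintro rfl
      obtain ⟨B, hB⟩ := M.exists_isBase
      exact hB.finite.encard_lt_top.ne (by rw [hB.encard_eq_eRank, hd]; simp)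
    lift d to ℕ using this
    exact h d r hd
  intro d
  induction d with
  | zero => intro r hr; rwa [truncation_eq_self (by simp [hr])]
  | succ d ih =>
    intro r hr
    have h1 : M.eRank = ((r + 1 : ℕ) : ℕ∞) + d := by
      rw [hr]; push_cast; rw [add_assoc, add_comm (d : ℕ∞)]
    have hT := ih (r + 1) h1
    have hTf := hT.1
    have hrank : (CompleteMatroidClass.truncation M (r + 1)).eRank = r + 1 := by
      obtain ⟨B, hB⟩ := (CompleteMatroidClass.truncation M (r + 1)).exists_isBase
      rw [← hB.encard_eq_eRank,
        ((truncation_isBase_iff (by rw [h1]; exact le_self_add)).1 hB).2]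
      norm_cast
    have := hT.truncation_of_eRank_eq hkl hrank
    convert this using 1
    refine Matroid.ext_indep rfl fun I _ => ?_
    simp only [truncation_indep_iff]
    refine ⟨fun h => ⟨⟨h.1, h.2.trans ?_⟩, h.2⟩, fun h => ⟨h.1.1, h.2⟩⟩
    exact_mod_cast Nat.le_succ r

/-! ### Principal extensions -/

/-- Independence in the principal extension of `M` by a new element `e` placed freely on `F`. -/
def PrincipalExtensionIndep (M : Matroid α) (F : Set α) (e : α) (I : Set α) : Prop :=
  M.Indep I ∨ e ∈ I ∧ ∃ f ∈ F, f ∉ I ∧ M.Indep (insert f (I \ {e}))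

theorem PrincipalExtensionIndep.encard_le {M : Matroid α} {F : Set α} {e : α} {I : Set α}
    (h : PrincipalExtensionIndep M F e I) : I.encard ≤ M.eRank := by
  rcases h with h | ⟨he, f, -, hfI, h⟩
  · exact h.encard_le_eRank
  · rw [← encard_exchange hfI he]
    exact h.encard_le_eRank

theorem PrincipalExtensionIndep.subset {M : Matroid α} {F : Set α} {e : α} {I J : Set α}
    (hJ : PrincipalExtensionIndep M F e J) (hIJ : I ⊆ J) : PrincipalExtensionIndep M F e I := by
  rcases hJ with h | ⟨he, f, hf, hfJ, h⟩
  · exact Or.inl (h.subset hIJ)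
  · by_cases heI : e ∈ I
    · exact Or.inr ⟨heI, f, hf, fun h' => hfJ (hIJ h'),
        h.subset (insert_subset_insert (sdiff_subset_sdiff_left hIJ))⟩
    · exact Or.inl (h.subset ((subset_sdiff_singleton hIJ heI).trans (subset_insert _ _)))

/-- The delicate case has e in both sets, with I - e + f and J - e + g independent in M.
Augmentation may offer g, which is not in J; then g replaces f as the stand-in for e in I, and a
second augmentation must add an element of J. -/
theorem PrincipalExtensionIndep.augment {M : Matroid α} {F : Set α} {e : α} (he : e ∉ M.E)
    {I J : Set α} (hI : PrincipalExtensionIndep M F e I) (hJ : PrincipalExtensionIndep M F e J)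
    (hIJ : I.encard < J.encard) : ∃ x ∈ J, x ∉ I ∧ PrincipalExtensionIndep M F e (insert x I) := by
  have hcomm : ∀ x f : α, x ≠ e → insert f (insert x I \ {e}) = insert x (insert f (I \ {e})) := by
    intro x f hx
    rw [insert_sdiff_of_notMem _ (by simpa using hx), insert_comm]
  rcases hI with hI | ⟨heI, f, hf, hfI, hI⟩
  · have heI : e ∉ I := fun h => he (hI.subset_ground h)
    rcases hJ with hJ | ⟨heJ, g, hg, hgJ, hJ⟩
    · obtain ⟨x, hx, hxI⟩ := hI.augment hJ hIJ
      exact ⟨x, hx.1, hx.2, Or.inl hxI⟩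
    · rw [← encard_exchange hgJ heJ] at hIJ
      obtain ⟨x, ⟨rfl | hx, hxI⟩, hins⟩ := hI.augment hJ hIJ
      -- The augmenting element is the stand-in for e in J, so e itself can join I.
      · refine ⟨e, heJ, heI, Or.inr ⟨Or.inl rfl, x, hg, ?_, ?_⟩⟩
        · rintro (rfl | h)
          · exact hgJ heJ
          · exact hxI h
        · rwa [insert_sdiff_self_of_notMem heI]
      · exact ⟨x, hx.1, hxI, Or.inl hins⟩
  · have hfin : ∀ x ∈ J, x ∉ I → x ≠ e → ∀ h ∈ F, h ∉ I → h ≠ x →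
        M.Indep (insert x (insert h (I \ {e}))) →
        ∃ x ∈ J, x ∉ I ∧ PrincipalExtensionIndep M F e (insert x I) := by
      intro x hxJ hxI hxe h hh hhI hhx hind
      refine ⟨x, hxJ, hxI, Or.inr ⟨Or.inr heI, h, hh, ?_, ?_⟩⟩
      · rintro (h' | h')
        · exact hhx h'
        · exact hhI h'
      · rwa [hcomm x h hxe]
    have hne : ∀ x, x ∉ insert f (I \ {e}) → x ≠ e → x ∉ I := fun x hx hxe hxI =>
      hx (Or.inr ⟨hxI, hxe⟩)
    rcases hJ with hJ | ⟨heJ, g, hg, hgJ, hJ⟩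
    · have hc := hIJ
      rw [← encard_exchange hfI heI] at hc
      obtain ⟨x, ⟨hx, hxI⟩, hins⟩ := hI.augment hJ hc
      have hxe : x ≠ e := fun h => he (hJ.subset_ground (h ▸ hx))
      exact hfin x hx (hne x hxI hxe) hxe f hf hfI (fun h => hxI (Or.inl h.symm)) hins
    · have hgfin : ∀ h ∈ F, h ∉ I → M.Indep (insert h (I \ {e})) →
          g ∈ insert h (I \ {e}) →
          ∃ x ∈ J, x ∉ I ∧ PrincipalExtensionIndep M F e (insert x I) := by
        intro h hh hhI hind hgh
        have hc := hIJ
        rw [← encard_exchange hhI heI, ← encard_exchange hgJ heJ] at hc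
        obtain ⟨x, ⟨rfl | hx, hxI⟩, hins⟩ := hind.augment hJ hc
        · exact absurd hgh hxI
        · exact hfin x hx.1 (fun h' => hxI (Or.inr ⟨h', hx.2⟩)) hx.2 h hh hhI
            (fun h' => hxI (Or.inl h'.symm)) hins
      by_cases hgI : g ∈ insert f (I \ {e})
      · exact hgfin f hf hfI hI hgI
      · have hc := hIJ
        rw [← encard_exchange hfI heI, ← encard_exchange hgJ heJ] at hc
        obtain ⟨x, ⟨rfl | hx, hxI⟩, hins⟩ := hI.augment hJ hc
        · have hxe : x ≠ e := fun h => hgJ (h ▸ heJ)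
          exact hgfin x hg (hne x hgI hxe)
            (hins.subset (insert_subset_insert (subset_insert _ _))) (Or.inl rfl)
        · exact hfin x hx.1 (fun h' => hxI (Or.inr ⟨h', hx.2⟩)) hx.2 f hf hfI
            (fun h' => hxI (Or.inl h'.symm)) hins

/-- The principal extension of `M` by a new element `e` placed freely on `F`. -/
def principalExtension (M : Matroid α) [M.RankFinite] (F : Set α) (e : α) (he : e ∉ M.E) :
    Matroid α :=
  (IndepMatroid.ofBddAugment (E := insert e M.E) (Indep := PrincipalExtensionIndep M F e)
    (indep_empty := Or.inl M.empty_indep)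
    (indep_subset := fun _ _ hJ hIJ => hJ.subset hIJ)
    (indep_aug := fun _ _ hI hJ hIJ => hI.augment he hJ hIJ)
    (indep_bdd := by
      obtain ⟨B, hB⟩ := M.exists_isBase
      refine ⟨B.ncard, fun I hI => ?_⟩
      rw [hB.finite.cast_ncard_eq, hB.encard_eq_eRank]
      exact hI.encard_le)
    (subset_ground := by
      rintro I (hI | ⟨-, f, -, -, hI⟩)
      · exact hI.subset_ground.trans (subset_insert _ _)
      · rw [← sdiff_singleton_subset_iff]
        exact (subset_insert _ _).trans hI.subset_ground)).matroid

section PrincipalExtension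

variable {M : Matroid α} [M.RankFinite] {F : Set α} {e : α} {he : e ∉ M.E}

theorem principalExtension_indep_iff {I : Set α} :
    (principalExtension M F e he).Indep I ↔
      M.Indep I ∨ e ∈ I ∧ ∃ f ∈ F, f ∉ I ∧ M.Indep (insert f (I \ {e})) := Iff.rfl

theorem principalExtension_isBase_iff {B : Set α} :
    (principalExtension M F e he).IsBase B ↔
      M.IsBase B ∨ e ∈ B ∧ ∃ f ∈ F, f ∉ B ∧ M.IsBase (insert f (B \ {e})) := by
  have key : ∀ B, PrincipalExtensionIndep M F e B → B.encard = M.eRank →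
      (principalExtension M F e he).IsBase B := by
    intro B hB hc
    obtain ⟨B₀, hB₀⟩ := M.exists_isBase
    have hfin : B.Finite := by
      rw [← encard_lt_top_iff, hc, ← hB₀.encard_eq_eRank]
      exact hB₀.finite.encard_lt_top
    refine Matroid.Indep.isBase_of_maximal hB fun J hJ hBJ => ?_
    exact hfin.eq_of_subset_of_encard_le hBJ (hc ▸ PrincipalExtensionIndep.encard_le hJ)
  constructor
  · intro h
    obtain ⟨B₀, hB₀⟩ := M.exists_isBase
    have hc := h.encard_eq_encard_of_isBase (key B₀ (Or.inl hB₀.indep) hB₀.encard_eq_eRank)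
    rw [hB₀.encard_eq_eRank] at hc
    rcases h.indep with hi | ⟨heB, f, hf, hfB, hi⟩
    · exact Or.inl (isBase_of_indep_of_eRank_le hi hc.ge)
    · exact Or.inr ⟨heB, f, hf, hfB,
        isBase_of_indep_of_eRank_le hi (by rw [encard_exchange hfB heB, hc])⟩
  · rintro (h | ⟨heB, f, hf, hfB, h⟩)
    · exact key B (Or.inl h.indep) h.encard_eq_eRank
    · exact key B (Or.inr ⟨heB, f, hf, hfB, h.indep⟩)
        (by rw [← encard_exchange hfB heB, h.encard_eq_eRank])

theorem principalExtension_isBase_insert {f : α} {T : Set α} (hf : f ∈ F) (heT : e ∉ T)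
    (hfT : f ∉ T) (h : M.IsBase (insert f T)) :
    (principalExtension M F e he).IsBase (insert e T) := by
  refine principalExtension_isBase_iff.2 (Or.inr ⟨Or.inl rfl, f, hf, ?_, ?_⟩)
  · rintro (rfl | h')
    · exact he (h.subset_ground (Or.inl rfl))
    · exact hfT h'
  · rwa [insert_sdiff_self_of_notMem heT]

theorem principalExtension_isBase_of_isBase {B : Set α} (h : M.IsBase B) :
    (principalExtension M F e he).IsBase B :=
  principalExtension_isBase_iff.2 (Or.inl h)

-- Here f plays the part of e: τ follows σ on I and sends e to σ f. If e ∈ X the exchanged set is a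
-- base of M; otherwise it is a base of M with f replaced by e.
open Classical in
theorem IsExchangeMap.principalExtension_left {k l : ℕ} {I B : Set α} {f : α} {σ : α → α}
    (hf : f ∈ F) (hfI : f ∉ I) (h₁ : M.IsBase (insert f I)) (h₂ : M.IsBase B)
    (hσ : IsExchangeMap M k l (insert f I) B σ) :
    ∃ τ, IsExchangeMap (principalExtension M F e he) k l (insert e I) B τ := by
  have heI : e ∉ I := fun h => he (h₁.subset_ground (Or.inr h))
  have heB : e ∉ B := fun h => he (h₂.subset_ground h)
  have hmaps : ∀ x ∈ I, σ x ∈ B := fun x hx => hσ.bijOn.mapsTo (Or.inr hx)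
  have hmapf : σ f ∈ B := hσ.bijOn.mapsTo (Or.inl rfl)
  have hinj : ∀ x ∈ I, ∀ y ∈ I, σ x = σ y → x = y := fun x hx y hy =>
    hσ.bijOn.injOn (Or.inr hx) (Or.inr hy)
  have hinjf : ∀ x ∈ I, σ x ≠ σ f := fun x hx h =>
    hfI (hσ.bijOn.injOn (Or.inr hx) (Or.inl rfl) h ▸ hx)
  have hτ : ∀ x ∈ I, Function.update σ e (σ f) x = σ x := fun x hx =>
    Function.update_of_ne (by rintro rfl; exact heI hx) _ _
  have hτe : Function.update σ e (σ f) e = σ f := Function.update_self _ _ _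
  refine ⟨Function.update σ e (σ f), ⟨?_, ?_, fun y hy => ?_⟩, ?_, fun X hX hs => ?_⟩
  · rintro x (rfl | hx)
    · rwa [hτe]
    · rw [hτ x hx]
      exact hmaps x hx
  · rintro x (rfl | hx) y (rfl | hy) hxy
    · rfl
    · rw [hτe, hτ y hy] at hxy
      exact absurd hxy.symm (hinjf y hy)
    · rw [hτe, hτ x hx] at hxy
      exact absurd hxy (hinjf x hx)
    · rw [hτ x hx, hτ y hy] at hxy
      exact hinj x hx y hy hxy
  · obtain ⟨x, rfl | hx, rfl⟩ := hσ.bijOn.surjOn hy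
    · exact ⟨e, Or.inl rfl, hτe⟩
    · exact ⟨x, Or.inr hx, hτ x hx⟩
  · rintro x (rfl | hx) hxB
    · exact absurd hxB heB
    · rw [hτ x hx, hσ.eq_self x (Or.inr hx) hxB]
  by_cases heX : e ∈ X
  · obtain ⟨X₀, heX₀, rfl⟩ : ∃ X₀, e ∉ X₀ ∧ insert e X₀ = X :=
      ⟨X \ {e}, by simp, by simp [heX]⟩
    have hX₀I : X₀ ⊆ I := fun x hx =>
      (hX (Or.inr hx)).1.resolve_left fun h => heX₀ (h ▸ hx)
    have h := hσ.isBase_of_subset (X := insert f X₀) (insert_subset_insert hX₀I) (by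
      refine hs.imp (fun h => ?_) fun h => (encard_le_encard ?_).trans h
      · rw [encard_insert_of_notMem heX₀] at h
        exact (encard_le_encard sdiff_subset).trans ((encard_insert_le _ _).trans h)
      · rintro y ⟨⟨rfl | hyI, hyB⟩, hyX⟩
        · exact absurd (Or.inl rfl) hyX
        · refine ⟨⟨Or.inr hyI, hyB⟩, ?_⟩
          rintro (rfl | h')
          · exact heI hyI
          · exact hyX (Or.inr h'))
    refine principalExtension_isBase_of_isBase ?_
    rw [image_insert_eq, insert_sdiff_insert_union_insert hfI] at h
    rwa [image_insert_eq, hτe, insert_sdiff_insert_union_insert heI,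
      image_congr fun x hx => hτ x (hX₀I hx)]
  · have hXI : X ⊆ I := fun x hx => (hX hx).1.resolve_left fun h => heX (h ▸ hx)
    have hfX : f ∉ X := fun h => hfI (hXI h)
    have h := hσ.isBase_of_subset (X := X) (hXI.trans (subset_insert _ _)) (by
      refine hs.imp (fun h => (encard_le_encard sdiff_subset).trans h) fun h => ?_
      -- As e lies in neither B nor X, it is counted among the unexchanged elements and makes room
      -- for f.
      rw [insert_sdiff_of_notMem _ heB, insert_sdiff_of_notMem _ heX,
        encard_insert_of_notMem fun h' => heI h'.1.1] at h
      refine (encard_le_encard (t := insert f ((I \ B) \ X)) ?_).trans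
        ((encard_insert_le _ _).trans h)
      rintro y ⟨⟨rfl | hyI, hyB⟩, hyX⟩
      · exact Or.inl rfl
      · exact Or.inr ⟨⟨hyI, hyB⟩, hyX⟩)
    rw [insert_sdiff_of_notMem _ hfX, insert_union] at h
    rw [insert_sdiff_of_notMem _ heX, insert_union, image_congr fun x hx => hτ x (hXI hx)]
    refine principalExtension_isBase_insert hf ?_ ?_ h
    · rintro (h' | ⟨x, hx, hxe⟩)
      · exact heI h'.1
      · exact heB (hxe ▸ hmaps x (hXI hx))
    · rintro (h' | ⟨x, hx, hxf⟩)
      · exact hfI h'.1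
      · have hfB : f ∈ B := hxf ▸ hmaps x (hXI hx)
        exact hinjf x (hXI hx) (hxf.trans (hσ.eq_self f (Or.inl rfl) hfB).symm)

-- The map from `exists_of_insert` is extended by e ↦ e. The element it adds is f or g, both in F,
-- so e can take its place.
open Classical in
theorem IsExchangeMap.principalExtension_both {k l : ℕ} {I J : Set α} {f g : α} {σ : α → α}
    (hf : f ∈ F) (hg : g ∈ F) (hfI : f ∉ I) (hgJ : g ∉ J) (h₁ : M.IsBase (insert f I))
    (h₂ : M.IsBase (insert g J)) (hσ : IsExchangeMap M k l (insert f I) (insert g J) σ) :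
    ∃ τ, IsExchangeMap (principalExtension M F e he) k l (insert e I) (insert e J) τ := by
  have heI : e ∉ I := fun h => he (h₁.subset_ground (Or.inr h))
  have heJ : e ∉ J := fun h => he (h₂.subset_ground (Or.inr h))
  obtain ⟨τ, hτ, hτfix, hτb⟩ := hσ.exists_of_insert hfI hgJ
  have hu : ∀ x ∈ I, Function.update τ e e x = τ x := fun x hx =>
    Function.update_of_ne (by rintro rfl; exact heI hx) _ _
  have hue : Function.update τ e e e = e := Function.update_self _ _ _
  refine ⟨Function.update τ e e, ⟨?_, ?_, ?_⟩, ?_, fun X hX hs => ?_⟩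
  · rintro x (rfl | hx)
    · rw [hue]
      exact Or.inl rfl
    · rw [hu x hx]
      exact Or.inr (hτ.mapsTo hx)
  · rintro x (rfl | hx) y (rfl | hy) hxy
    · rfl
    · rw [hue, hu y hy] at hxy
      exact absurd (hxy ▸ hτ.mapsTo hy) heJ
    · rw [hue, hu x hx] at hxy
      exact absurd (hxy ▸ hτ.mapsTo hx) heJ
    · rw [hu x hx, hu y hy] at hxy
      exact hτ.injOn hx hy hxy
  · rintro y (rfl | hy)
    · exact ⟨y, Or.inl rfl, hue⟩
    · obtain ⟨x, hx, rfl⟩ := hτ.surjOn hy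
      exact ⟨x, Or.inr hx, hu x hx⟩
  · rintro x (rfl | hx) hxJ
    · exact hue
    · rw [hu x hx, hτfix x hx (hxJ.resolve_left (by rintro rfl; exact heI hx))]
  · have hd : insert e I \ insert e J = I \ J := by
      rw [insert_sdiff_of_mem _ (mem_insert _ _), sdiff_insert_of_notMem heI]
    rw [hd] at hX hs
    have heX : e ∉ X := fun h => heI (hX h).1
    rw [insert_sdiff_of_notMem _ heX, insert_union, image_congr fun x hx => hu x (hX hx).1]
    obtain ⟨h, hfg, hh, hb⟩ := hτb X hX hs
    refine principalExtension_isBase_insert (f := h) ?_ ?_ hh hb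
    · rcases hfg with rfl | rfl <;> assumption
    · rintro (h' | ⟨x, hx, hxe⟩)
      · exact heI h'.1
      · exact heJ (hxe ▸ hτ.mapsTo (hX hx).1)

end PrincipalExtension

theorem KLBaseOrderable.principalExtension {k l : ℕ} (hkl : 0 < k + l) {M : Matroid α}
    [M.RankFinite] (hM : KLBaseOrderable k l M) (F : Set α) (e : α) (he : e ∉ M.E) :
    KLBaseOrderable k l (principalExtension M F e he) := by
  have hMf := hM.1
  have : (CompleteMatroidClass.principalExtension M F e he).Finite := ⟨M.ground_finite.insert e⟩
  refine klBaseOrderable_of_exchange fun B₁ B₂ h₁ h₂ => ?_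
  rw [principalExtension_isBase_iff] at h₁ h₂
  rcases h₁ with h₁ | ⟨he₁, f, hf, hf₁, h₁⟩ <;> rcases h₂ with h₂ | ⟨he₂, g, hg, hg₂, h₂⟩
  · obtain ⟨σ, hσ⟩ := hM.exists_exchange hkl h₁ h₂
    exact ⟨σ, hσ.bijOn, hσ.eq_self, fun X hX hs =>
      principalExtension_isBase_of_isBase (hσ.isBase X hX hs)⟩
  · obtain ⟨σ, hσ⟩ := hM.exists_exchange hkl h₁ h₂
    -- The mirrored case: pass to the inverse, with k and l interchanged, and back.
    obtain ⟨ρ, hρ⟩ := hσ.exists_symm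
    obtain ⟨τ, hτ⟩ := hρ.principalExtension_left (he := he) hg (fun h => hg₂ h.1) h₂ h₁
    rw [insert_sdiff_singleton, insert_eq_of_mem he₂] at hτ
    exact hτ.exists_symm
  · obtain ⟨σ, hσ⟩ := hM.exists_exchange hkl h₁ h₂
    have := hσ.principalExtension_left (he := he) hf (fun h => hf₁ h.1) h₁ h₂
    rwa [insert_sdiff_singleton, insert_eq_of_mem he₁] at this
  · obtain ⟨σ, hσ⟩ := hM.exists_exchange hkl h₁ h₂
    have := hσ.principalExtension_both (he := he) hf hg (fun h => hf₁ h.1) (fun h => hg₂ h.1) h₁ h₂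
    rwa [insert_sdiff_singleton, insert_eq_of_mem he₁, insert_sdiff_singleton,
      insert_eq_of_mem he₂] at this

/-! ### Bipartite induction by free placement -/

theorem injOn_update_insert [DecidableEq α] {f : α → β} {T : Set α} {a b : α}
    (ha : a ∉ T) (hb : b ∉ T)
    (hf : InjOn f (insert a T)) : InjOn (Function.update f b (f a)) (insert b T) := by
  have hu : ∀ x ∈ T, Function.update f b (f a) x = f x := fun x hx =>
    Function.update_of_ne (fun h => hb (by rwa [← h])) _ _
  have hub : Function.update f b (f a) b = f a := Function.update_self _ _ _
  rintro x (rfl | hx) y (rfl | hy) hxy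
  · rfl
  · rw [hub, hu y hy] at hxy
    exact absurd (by rwa [hf (Or.inl rfl) (Or.inr hy) hxy]) ha
  · rw [hub, hu x hx] at hxy
    exact absurd (by rwa [← hf (Or.inr hx) (Or.inl rfl) hxy]) ha
  · rw [hu x hx, hu y hy] at hxy
    exact hf (Or.inr hx) (Or.inr hy) hxy

theorem image_update_insert [DecidableEq α] {f : α → β} {T : Set α} {a b : α} (hb : b ∉ T) :
    Function.update f b (f a) '' insert b T = f '' insert a T := by
  rw [image_insert_eq, image_insert_eq, Function.update_self]
  congr 1
  exact image_congr fun x hx => Function.update_of_ne (fun h => hb (by rwa [← h])) _ _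

/-- Place new elements `Sum.inr v`, for `v ∈ S`, freely on the sets `A v`. -/
theorem KLBaseOrderable.exists_free_extension {k l : ℕ} (hkl : 0 < k + l) {M : Matroid α}
    (hM : KLBaseOrderable k l M) (A : α → Set α) (S : Set α) (hS : S.Finite) :
    ∃ N : Matroid (α ⊕ α), KLBaseOrderable k l N ∧ N.E = Sum.inl '' M.E ∪ Sum.inr '' S ∧
      ∀ K, N.Indep K ↔ K ⊆ range Sum.inl ∪ Sum.inr '' S ∧
        ∃ f : α ⊕ α → α, InjOn f K ∧ (∀ z ∈ K, f z ∈ Sum.elim singleton A z) ∧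
          M.Indep (f '' K) := by
  classical
  induction S, hS using Set.Finite.induction_on with
  | empty =>
    refine ⟨M.map Sum.inl Sum.inl_injective.injOn, hM.map hkl Sum.inl_injective, by simp,
      fun K => ?_⟩
    rw [Matroid.map_indep_iff]
    constructor
    · rintro ⟨I, hI, rfl⟩
      refine ⟨by simp, Sum.elim id id, ?_, ?_, ?_⟩
      · rintro _ ⟨x, hx, rfl⟩ _ ⟨y, hy, rfl⟩ hxy
        exact congrArg _ hxy
      · rintro _ ⟨x, hx, rfl⟩
        exact rfl
      · rw [image_image]
        simpa using hI
    · rintro ⟨hK, f, -, hfA, hind⟩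
      refine ⟨_, hind, ?_⟩
      have hK' : ∀ z ∈ K, Sum.inl (f z) = z := by
        intro z hz
        rcases hK hz with ⟨x, rfl⟩ | ⟨x, hx, -⟩
        · exact congrArg Sum.inl (hfA _ hz)
        · exact hx.elim
      rw [image_image]
      conv_lhs => rw [← image_id K]
      exact image_congr fun z hz => (hK' z hz).symm
  | @insert v S hvS hS ih =>
    obtain ⟨N, hN, hNE, hNind⟩ := ih
    have hNf := hN.1
    have he : Sum.inr v ∉ N.E := by rw [hNE]; simp [hvS]
    have hrange : range Sum.inl ∪ Sum.inr '' insert v S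
        = insert (Sum.inr v : α ⊕ α) (range Sum.inl ∪ Sum.inr '' S) := by
      rw [image_insert_eq, union_insert]
    refine ⟨_, hN.principalExtension hkl (Sum.inl '' A v) (Sum.inr v) he, ?_, fun K => ?_⟩
    · change insert (Sum.inr v) N.E = _
      rw [hNE, image_insert_eq, union_insert]
    rw [principalExtension_indep_iff, hNind, hrange]
    by_cases heK : Sum.inr v ∈ K
    swap
    · rw [subset_insert_iff_of_notMem heK]
      exact ⟨fun h => h.resolve_right fun h' => heK h'.1, Or.inl⟩
    have heT : Sum.inr v ∉ K \ {Sum.inr v} := fun h => h.2 rfl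
    have hKT : insert (Sum.inr v) (K \ {Sum.inr v}) = K := by
      rw [insert_sdiff_singleton, insert_eq_of_mem heK]
    constructor
    · rintro (h | ⟨-, _, ⟨w, hw, rfl⟩, hwK, h⟩)
      · exact ⟨h.1.trans (subset_insert _ _), h.2⟩
      obtain ⟨hsub, f, hf, hfA, hind⟩ := (hNind _).1 h
      -- A matching must send `Sum.inl w` to w; the new element takes over this value.
      have hfw : f (Sum.inl w) = w := hfA _ (Or.inl rfl)
      have hwT : Sum.inl w ∉ K \ {Sum.inr v} := fun h => hwK h.1
      refine ⟨sdiff_singleton_subset_iff.1 ((subset_insert _ _).trans hsub),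
        Function.update f (Sum.inr v) (f (Sum.inl w)), ?_, fun z hz => ?_, ?_⟩
      · exact hKT ▸ injOn_update_insert hwT heT hf
      · by_cases hzv : z = Sum.inr v
        · rw [hzv, Function.update_self, hfw]
          exact hw
        · rw [Function.update_of_ne hzv]
          exact hfA z (Or.inr ⟨hz, hzv⟩)
      · have := image_update_insert (f := f) (a := Sum.inl w) heT
        rw [hKT] at this
        rwa [this]
    · rintro ⟨hsub, f, hf, hfA, hind⟩
      -- The old copy of the target of `Sum.inr v` has the same target, so injectivity keeps it out
      -- of K.
      have hwK : Sum.inl (f (Sum.inr v)) ∉ K := fun h => by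
        have := hf h heK (hfA _ h)
        simp at this
      have hwT : Sum.inl (f (Sum.inr v)) ∉ K \ {Sum.inr v} := fun h => hwK h.1
      refine Or.inr ⟨heK, _, mem_image_of_mem _ (hfA _ heK), hwK, (hNind _).2 ⟨?_,
        Function.update f (Sum.inl (f (Sum.inr v))) (f (Sum.inr v)), ?_, ?_, ?_⟩⟩
      · exact insert_subset (Or.inl ⟨_, rfl⟩) (sdiff_singleton_subset_iff.2 hsub)
      · exact injOn_update_insert heT hwT (hKT.symm ▸ hf)
      · rintro z (rfl | hz)
        · rw [Function.update_self]
          exact rfl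
        · rw [Function.update_of_ne fun h => hwT (by rwa [← h])]
          exact hfA z hz.1
      · rwa [image_update_insert hwT, hKT]

/-- The matroid whose independent sets are those that can be matched, along the bipartite graph
with neighbourhoods `A v`, into an independent set of `M`. -/
theorem KLBaseOrderable.exists_bipartite_induction {k l : ℕ} (hkl : 0 < k + l) [Finite α]
    {M : Matroid α} (hM : KLBaseOrderable k l M) (A : α → Set α) :
    ∃ N : Matroid α, KLBaseOrderable k l N ∧ N.E = univ ∧
      ∀ I, N.Indep I ↔ ∃ f : α → α, InjOn f I ∧ (∀ v ∈ I, f v ∈ A v) ∧ M.Indep (f '' I) := by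
  obtain ⟨N, hN, hNE, hNind⟩ := hM.exists_free_extension hkl A univ finite_univ
  have hr : range Sum.inr ⊆ N.E := by
    rw [hNE, image_univ]
    exact subset_union_right
  have hE : (N.comap Sum.inr).E = univ := by
    rw [Matroid.comap_ground_eq, eq_univ_iff_forall]
    exact fun x => hr ⟨x, rfl⟩
  refine ⟨N.comap Sum.inr, KLBaseOrderable.of_map (β := α ⊕ α) hkl Sum.inr_injective ?_, hE,
    fun I => ?_⟩
  · convert hN.restrict hkl hr using 1
    refine Matroid.ext_indep (by rw [Matroid.map_ground, hE, image_univ]; rfl) fun K _ => ?_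
    rw [Matroid.map_indep_iff, Matroid.restrict_indep_iff]
    constructor
    · rintro ⟨I, hI, rfl⟩
      exact ⟨(Matroid.comap_indep_iff.1 hI).1, image_subset_range _ _⟩
    · rintro ⟨hK, hKr⟩
      refine ⟨Sum.inr ⁻¹' K, Matroid.comap_indep_iff.2 ⟨?_, Sum.inr_injective.injOn⟩, ?_⟩
      · rwa [image_preimage_eq_of_subset hKr]
      · rw [image_preimage_eq_of_subset hKr]
  · rw [Matroid.comap_indep_iff, hNind]
    constructor
    · rintro ⟨⟨-, f, hf, hfA, hind⟩, -⟩
      refine ⟨f ∘ Sum.inr, fun x hx y hy hxy => Sum.inr_injective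
        (hf (mem_image_of_mem _ hx) (mem_image_of_mem _ hy) hxy),
        fun v hv => hfA _ (mem_image_of_mem _ hv), ?_⟩
      rwa [image_comp]
    · rintro ⟨f, hf, hfA, hind⟩
      refine ⟨⟨(image_mono (subset_univ _)).trans subset_union_right, Sum.elim id f, ?_, ?_, ?_⟩,
        Sum.inr_injective.injOn⟩
      · rintro _ ⟨x, hx, rfl⟩ _ ⟨y, hy, rfl⟩ hxy
        exact congrArg _ (hf hx hy hxy)
      · rintro _ ⟨x, hx, rfl⟩
        exact hfA x hx
      · rwa [image_image]

/-! ### Linkings and matchings -/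

section Linkage

variable {V : Type*} {Γ : Digraph V} {B X Y : Set V}

/-- The orbit of x returns to x ∈ B, and the point just before the return lies in Y. -/
theorem exists_iterate_mem [Finite V] {π : Equiv.Perm V} (h : ∀ v, π v ∈ B ↔ v ∈ Y) {x : V}
    (hx : x ∈ B) : ∃ n, π^[n] x ∈ Y := by
  refine ⟨orderOf π - 1, ?_⟩
  have hpow : π^[orderOf π - 1 + 1] x = x := by
    rw [Nat.sub_one_add_one (orderOf_pos π).ne', ← Equiv.Perm.coe_pow, pow_orderOf_eq_one]
    rfl
  rw [← h, ← Function.iterate_succ_apply' π, Nat.succ_eq_add_one, hpow]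
  exact hx

/-- If the iterates of a permutation move along edges until they leave `Yᶜ`, then the set `B` of
images of `Y` is linked to `Y`. -/
theorem isLinked_of_perm [Finite V] (π : Equiv.Perm V) (h : ∀ v, π v ∈ B ↔ v ∈ Y)
    (hadj : ∀ v, v ∉ Y → π v = v ∨ Γ.Adj v (π v)) : IsLinked Γ B Y := by
  classical
  have hex : ∀ x : B, ∃ n, π^[n] x ∈ Y := fun x => exists_iterate_mem h x.2
  set n : B → ℕ := fun x => Nat.find (hex x)
  have hn : ∀ x, π^[n x] x ∈ Y := fun x => Nat.find_spec (hex x)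
  have hmin : ∀ (x : B) i, π^[i] x ∈ Y → n x ≤ i := fun x i hi => Nat.find_min' (hex x) hi
  -- If two orbit segments met with i < j, cancelling would put x on the orbit of x' after a
  -- positive number of steps; its predecessor there would lie in Y before time n x'.
  have key' : ∀ x x' : B, ∀ i j, i ≤ j → j ≤ n x' → π^[i] x = π^[j] x' → x = x' ∧ i = j := by
    intro x x' i j hij hj heq
    obtain ⟨d, rfl⟩ := Nat.exists_eq_add_of_le hij
    rw [Function.iterate_add_apply] at heq
    have hx := π.injective.iterate i heq
    cases d with
    | zero => exact ⟨Subtype.ext hx, rfl⟩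
    | succ d =>
      rw [Function.iterate_succ_apply'] at hx
      have := hmin x' d ((h _).1 (hx ▸ x.2))
      omega
  have key : ∀ x x' : B, ∀ i j, i ≤ n x → j ≤ n x' → π^[i] x = π^[j] x' → x = x' ∧ i = j := by
    intro x x' i j hi hj heq
    rcases le_total i j with hij | hij
    · exact key' x x' i j hij hj heq
    · have := key' x' x j i hij hi heq.symm
      exact ⟨this.1.symm, this.2.symm⟩
  set t : B → Y := fun x => ⟨π^[n x] x, hn x⟩
  have ht : t.Injective := fun x x' hxx =>
    (key x x' _ _ le_rfl le_rfl (congrArg Subtype.val hxx)).1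
  -- π shows that B and Y are equinumerous, so the injection t is bijective.
  have e : B ≃ Y := (π.subtypeEquiv fun v => (h v).symm).symm
  refine ⟨Equiv.ofBijective t ⟨ht, (Finite.injective_iff_surjective_of_equiv e).1 ht⟩,
    fun x => (List.range (n x + 1)).map fun i => π^[i] x, fun x => ⟨?_, ?_, ?_, ?_⟩, ?_⟩
  · rw [List.isChain_map, ← Nat.succ_eq_add_one, List.isChain_range_succ]
    intro m hm
    have hmY : π^[m] x ∉ Y := fun h' => absurd (hmin x m h') (by omega)
    rw [Function.iterate_succ_apply']
    refine (hadj _ hmY).resolve_left fun h' => ?_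
    have := (key x x (m + 1) m hm hm.le (by rw [Function.iterate_succ_apply']; exact h')).2
    omega
  · refine List.Nodup.map_on (fun i hi j hj hij => ?_) List.nodup_range
    rw [List.mem_range, Nat.lt_succ_iff] at hi hj
    exact (key x x i j hi hj hij).2
  · simp [List.range_succ_eq_map]
  · simp [List.range_succ, t, Equiv.ofBijective]
  · intro x x' hxx v hv hv'
    obtain ⟨i, hi, rfl⟩ := List.mem_map.1 hv
    obtain ⟨j, hj, hij⟩ := List.mem_map.1 hv'
    rw [List.mem_range, Nat.lt_succ_iff] at hi hj
    exact hxx (key x x' i j hi hj hij.symm).1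

/-- The bijection from Bᶜ to its image extends to a permutation of V, whose inverse follows edges
forwards from g v to v. -/
theorem isLinked_of_matching [Finite V] {g : V → V} (hg : InjOn g Bᶜ)
    (hadj : ∀ v, v ∉ B → g v = v ∨ Γ.Adj (g v) v) : IsLinked Γ B (g '' Bᶜ)ᶜ := by
  classical
  have := Fintype.ofFinite V
  let e : {x // x ∈ Bᶜ} ≃ {x // x ∈ g '' Bᶜ} := hg.bijOn_image.equiv
  have he : ∀ v (hv : v ∈ Bᶜ), e.extendSubtype v = g v := fun v hv =>
    e.extendSubtype_apply_of_mem v hv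
  have hmem : ∀ v, e.extendSubtype v ∈ g '' Bᶜ ↔ v ∈ Bᶜ := fun v => by
    constructor
    · rintro h'
      by_contra hv
      exact e.extendSubtype_not_mem v hv h'
    · exact fun hv => e.extendSubtype_mem v hv
  refine isLinked_of_perm e.extendSubtype.symm (fun v => ?_) fun v hv => ?_
  · have := hmem (e.extendSubtype.symm v)
    rw [Equiv.apply_symm_apply] at this
    rw [mem_compl_iff, this, mem_compl_iff, not_not]
  · rw [mem_compl_iff, not_not] at hv
    obtain ⟨w, hw, rfl⟩ := hv
    rw [← he w hw, Equiv.symm_apply_apply, he w hw]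
    exact (hadj w hw).imp_left Eq.symm

theorem IsLinked.exists_subset (h : IsLinked Γ B Y) (hX : X ⊆ B) :
    ∃ Y' ⊆ Y, IsLinked Γ X Y' := by
  obtain ⟨t, P, hP, hdisj⟩ := h
  let φ : X → V := fun x => t (inclusion hX x)
  have hφ : φ.Injective := fun x y hxy =>
    inclusion_injective hX (t.injective (Subtype.ext hxy))
  refine ⟨range φ, ?_, Equiv.ofInjective φ hφ, fun x => P (inclusion hX x),
    fun x => hP (inclusion hX x), fun x x' hxx => hdisj _ _ fun h' => hxx
      (inclusion_injective hX h')⟩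
  rintro _ ⟨x, rfl⟩
  exact (t _).2

/-- A vertex outside Y moves to its successor on its path, or stays put if it is on no path.
Disjointness of the paths gives injectivity, and initial vertices are never successors. -/
theorem IsLinked.exists_matching (h : IsLinked Γ X Y) :
    ∃ f : V → V, InjOn f Yᶜ ∧ ∀ v, v ∉ Y → f v ∉ X ∧ (f v = v ∨ Γ.Adj v (f v)) := by
  classical
  obtain ⟨t, P, hP, hdisj⟩ := h
  have hsame : ∀ x x' : X, ∀ v, v ∈ P x → v ∈ P x' → x = x' := fun x x' v hv hv' =>
    by_contra fun hne => hdisj x x' hne hv hv'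
  let R : V → V → Prop := fun v w =>
    (∃ (x : X) (i : ℕ), (P x)[i]? = some v ∧ (P x)[i + 1]? = some w) ∨ w = v ∧ ∀ x : X, v ∉ P x
  have hidx : ∀ (x : X) (i j : ℕ) (v : V), (P x)[i]? = some v → (P x)[j]? = some v → i = j := by
    intro x i j v hi hj
    obtain ⟨hi', hi⟩ := List.getElem?_eq_some_iff.1 hi
    obtain ⟨hj', hj⟩ := List.getElem?_eq_some_iff.1 hj
    exact ((hP x).2.1.getElem_inj_iff).1 (hi.trans hj.symm)
  have hmem : ∀ (x : X) (i : ℕ) (v : V), (P x)[i]? = some v → v ∈ P x := fun x i v hi =>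
    List.mem_of_getElem? hi
  have hex : ∀ v, v ∉ Y → ∃ w, R v w := by
    intro v hv
    by_cases hvP : ∃ x : X, v ∈ P x
    · obtain ⟨x, hx⟩ := hvP
      obtain ⟨i, hi, rfl⟩ := List.mem_iff_getElem.1 hx
      by_cases hi' : i + 1 < (P x).length
      · exact ⟨(P x)[i + 1], Or.inl ⟨x, i, by simp [hi], by simp [hi']⟩⟩
      · exfalso
        have hlast := (hP x).2.2.2
        rw [List.getLast?_eq_getElem?, show (P x).length - 1 = i by omega,
          List.getElem?_eq_getElem hi, Option.some_inj] at hlast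
        exact hv (hlast ▸ (t x).2)
    · exact ⟨v, Or.inr ⟨rfl, fun x hx => hvP ⟨x, hx⟩⟩⟩
  have hinj : ∀ v v' w, R v w → R v' w → v = v' := by
    rintro v v' w (⟨x, i, hi, hi'⟩ | ⟨rfl, h⟩) (⟨y, j, hj, hj'⟩ | ⟨rfl, h'⟩)
    · obtain rfl := hsame x y w (hmem _ _ _ hi') (hmem _ _ _ hj')
      obtain rfl : i = j := by simpa using hidx x _ _ w hi' hj'
      exact Option.some_inj.1 (hi.symm.trans hj)
    · exact absurd (hmem _ _ _ hi') (h' x)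
    · exact absurd (hmem _ _ _ hj') (h y)
    · rfl
  have hnot : ∀ v w, R v w → w ∉ X := by
    intro v w hR hw
    have hhead : (P ⟨w, hw⟩)[0]? = some w := by
      rw [← List.head?_eq_getElem?]
      exact (hP ⟨w, hw⟩).2.2.1
    rcases hR with ⟨x, i, hi, hi'⟩ | ⟨rfl, h⟩
    · obtain rfl := hsame x ⟨w, hw⟩ w (hmem _ _ _ hi') (hmem _ _ _ hhead)
      exact absurd (hidx _ _ _ w hi' hhead) (by omega)
    · exact h _ (hmem _ _ _ hhead)
  have hadj : ∀ v w, R v w → w = v ∨ Γ.Adj v w := by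
    rintro v w (⟨x, i, hi, hi'⟩ | ⟨rfl, h⟩)
    · obtain ⟨h1, hi⟩ := List.getElem?_eq_some_iff.1 hi
      obtain ⟨h2, hi'⟩ := List.getElem?_eq_some_iff.1 hi'
      subst hi hi'
      exact Or.inr ((hP x).1.getElem i h2)
    · exact Or.inl rfl
  choose! f hf using hex
  exact ⟨f, fun v hv v' hv' heq => hinj v v' (f v) (hf v hv) (heq ▸ hf v' hv'),
    fun v hv => ⟨hnot v _ (hf v hv), hadj v _ (hf v hv)⟩⟩

end Linkage

/-! ### Induction by digraphs -/

/-- Because v ∈ A v, the identity matches every independent set of M to itself, so M and N have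
equal rank. -/
theorem isBase_iff_of_matching {V : Type*} [Finite V] {M N : Matroid V} {A : V → Set V}
    (hA : ∀ v, v ∈ A v)
    (hN : ∀ I, N.Indep I ↔ ∃ f : V → V, InjOn f I ∧ (∀ v ∈ I, f v ∈ A v) ∧ M.Indep (f '' I))
    {W : Set V} : N.IsBase W ↔
      ∃ f : V → V, InjOn f W ∧ (∀ v ∈ W, f v ∈ A v) ∧ M.IsBase (f '' W) := by
  have hfM : M.Finite := ⟨toFinite _⟩
  have hfN : N.Finite := ⟨toFinite _⟩
  constructor
  · intro h
    obtain ⟨f, hf, hfA, hind⟩ := (hN W).1 h.indep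
    refine ⟨f, hf, hfA, isBase_of_indep_of_eRank_le hind ?_⟩
    obtain ⟨B, hB⟩ := M.exists_isBase
    rw [hf.encard_image, h.encard_eq_eRank, ← hB.encard_eq_eRank]
    refine Matroid.Indep.encard_le_eRank ((hN B).2 ⟨id, injOn_id _, fun v _ => hA v, ?_⟩)
    rw [image_id]
    exact hB.indep
  · rintro ⟨f, hf, hfA, hb⟩
    refine isBase_of_indep_of_eRank_le ((hN W).2 ⟨f, hf, hfA, hb.indep⟩) ?_
    obtain ⟨W', hW'⟩ := N.exists_isBase
    obtain ⟨g, hg, -, hind⟩ := (hN W').1 hW'.indep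
    rw [← hW'.encard_eq_eRank, ← hg.encard_image, ← hf.encard_image, hb.encard_eq_eRank]
    exact hind.encard_le_eRank

/-- Vertices outside the ground set become loops, so that dualising takes complements in all of V.
-/
theorem KLBaseOrderable.restrict_univ {k l : ℕ} {V : Type*} [Finite V] {M : Matroid V}
    (hM : KLBaseOrderable k l M) : KLBaseOrderable k l (M ↾ univ) := by
  have hb : ∀ B, (M ↾ univ).IsBase B ↔ M.IsBase B := fun B => by
    rw [Matroid.isBase_restrict_iff', Matroid.isBasis'_iff_isBasis_inter_ground, univ_inter,
      Matroid.isBasis_ground_iff]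
  have hr : (M ↾ univ).eRank = M.eRank := by
    obtain ⟨B, hB⟩ := M.exists_isBase
    rw [← hB.encard_eq_eRank, ← ((hb B).2 hB).encard_eq_eRank]
  refine ⟨⟨toFinite _⟩, fun B₁ B₂ h₁ h₂ => ?_⟩
  obtain ⟨σ, hσ⟩ := hM.2 B₁ B₂ ((hb _).1 h₁) ((hb _).1 h₂)
  exact ⟨σ, fun X hX => (hb _).2 (hσ X (hr ▸ hX))⟩

theorem KLBaseOrderable.exists_induced {k l : ℕ} (hkl : 0 < k + l) {V : Type*} [Finite V]
    (Γ : Digraph V) {M : Matroid V} (hM : KLBaseOrderable k l M) :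
    ∃ N : Matroid V, IsInducedBy Γ M N ∧ KLBaseOrderable k l N := by
  have hM' := hM.restrict_univ
  have hind : ∀ I, (M ↾ univ).Indep I ↔ M.Indep I := fun I => by simp
  have hME : (M ↾ univ).E = univ := rfl
  generalize M ↾ univ = M' at hM' hind hME
  obtain ⟨N, hN, hNE, hNind⟩ := (hM'.dual hkl).exists_bipartite_induction hkl
    (fun v => {w | w = v ∨ Γ.Adj w v})
  have hNb := fun W => isBase_iff_of_matching (W := W) (A := fun v => {w | w = v ∨ Γ.Adj w v})
    (fun v => Or.inl rfl) hNind
  refine ⟨N✶, ⟨hNE, fun X => ⟨fun hX => ?_, ?_⟩⟩, hN.dual hkl⟩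
  · obtain ⟨B, hB, hXB⟩ := hX.exists_isBase_superset
    rw [Matroid.dual_isBase_iff', hNE, ← compl_eq_univ_sdiff, hNb] at hB
    obtain ⟨⟨f, hf, hfA, hfb⟩, -⟩ := hB
    obtain ⟨Y, hY, hXY⟩ := (isLinked_of_matching hf hfA).exists_subset hXB
    rw [Matroid.dual_isBase_iff', hME, ← compl_eq_univ_sdiff] at hfb
    exact ⟨Y, (hind Y).1 (hfb.1.indep.subset hY), hXY⟩
  · rintro ⟨Y, hY, hXY⟩
    -- The image of Bᶜ under f is matched back onto Bᶜ, so it is a base of N, and it avoids X.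
    obtain ⟨f, hf, hfX⟩ := hXY.exists_matching
    obtain ⟨B, hB, hYB⟩ := ((hind Y).2 hY).exists_isBase_superset
    have hBY : Bᶜ ⊆ Yᶜ := compl_subset_compl.2 hYB
    have hfB : InjOn f Bᶜ := hf.mono hBY
    have hW : N.IsBase (f '' Bᶜ) := by
      rcases isEmpty_or_nonempty V with hV | hV
      · rw [hNb]
        refine ⟨id, injOn_id _, fun v => hV.elim v, ?_⟩
        rw [Matroid.dual_isBase_iff', hME]
        refine ⟨?_, subset_univ _⟩
        convert hB using 1
        exact Subsingleton.elim _ _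
      have hinv : ∀ v ∈ Bᶜ, Function.invFunOn f Bᶜ (f v) = v := fun v hv =>
        hfB.leftInvOn_invFunOn hv
      rw [hNb]
      refine ⟨Function.invFunOn f Bᶜ, ?_, ?_, ?_⟩
      · rintro _ ⟨v, hv, rfl⟩ _ ⟨w, hw, rfl⟩ hvw
        rw [hinv v hv, hinv w hw] at hvw
        rw [hvw]
      · rintro _ ⟨v, hv, rfl⟩
        rw [hinv v hv]
        exact (hfX v (hBY hv)).2.imp_left Eq.symm
      · rw [image_image, image_congr hinv, image_id', Matroid.dual_isBase_iff', hME,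
          ← compl_eq_univ_sdiff, compl_compl]
        exact ⟨hB, subset_univ _⟩
    have hNd : N✶.IsBase (f '' Bᶜ)ᶜ := by
      rw [Matroid.dual_isBase_iff', hNE, ← compl_eq_univ_sdiff, compl_compl]
      exact ⟨hW, subset_univ _⟩
    refine hNd.indep.subset ?_
    rintro x hx ⟨v, hv, rfl⟩
    exact (hfX v (hBY hv)).1 hx

end CompleteMatroidClass

theorem mainTheorem9 (k l : ℕ) (hkl : 0 < k + l) :
    CompleteMatroidClass.IsComplete.{u} (CompleteMatroidClass.KLBaseOrderable.{u} k l) where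
  finite _ hM := hM.1
  iso _ _ hM h := hM.iso hkl h
  minor _ _ hM h := hM.minor hkl h
  dual _ hM := hM.dual hkl
  directSum _ _ hM hN := hM.sum hkl hN
  truncation _ r hM := hM.truncation hkl r
  induced Γ _ hM := hM.exists_induced hkl Γ
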